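/- **Setting.** Let $0<r_1<r_2<\infty$ and let $U:[r_1,r_2]\to\mathbb R$ be strictly monotone and differentiable, with $U'$ Lipschitz continuous and without zeros. Put $a=\min(U(r_1),U(r_2))$, $b=\max(U(r_1),U(r_2))$ and, for $y\in[a,b]$, $r(y)=U^{-1}(y)$, $g(y)=U'(U^{-1}(y))$. Let $k\in 2\pi(\mathbb Z\setminus\{0\})$, let $h:[a,b]\to\mathbb C$ be in $W^{1,\infty}$, and write $L^2=L^2([a,b];\mathbb C)$, $D_t=\frac{\partial_y}{k}-it$. * For $w\in L^2$ and $t\in\mathbb R$, $L_tw$ is the solution $\Phi$ of $\big((gD_t)^2+\frac{g}{kr}D_t-\frac1{r^2}\big)\Phi=w$ with $\Phi=0$ at $y=a,b$. * *Euler's equations in scattering formulation* are $\partial_tW=\frac{ih}{k}L_tW$ in $L^2$. * $\|u\|_{\tilde H^1_t}^2=\|u\|_{L^2}^2+\|D_tu\|_{L^2}^2$ for $u\in H^1([a,b])$, and $\|v\|_{\tilde H^{-1}_t}=\|\Psi\|_{\tilde H^1_t}$ for $v\in L^2$, where $\Psi$ is the solution of $(-1+D_t^2)\Psi=v$ with $\Psi=0$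 at $y=a,b$. * $A(t)$ is the Fourier multiplier $A(t)\sum_nu_ne_n=\sum_n\exp\big(\arctan(\tfrac nk-t)\big)u_ne_n$ on $L^2$, where $e_n=(b-a)^{-1/2}e^{iny}$ and $n$ runs through $\frac{2\pi}{b-a}\mathbb Z$. For fixed $u$, $\langle u,\dot A(t)u\rangle=\frac{d}{dt}\langle u,A(t)u\rangle$. **Constants.** Consider, for constants $C_2>0$ and $C>0$ and for the given $k$, the inequalities $$\text{(i)}\quad \|u\|_{\tilde H^{-1}_t}\|A(t)u\|_{\tilde H^{-1}_t}\le -C_2\langle u,\dot A(t)u\rangle,\qquad \text{(ii)}\quad \|L_tu\|_{\tilde H^1_t}\le \tfrac C2\|u\|_{\tilde H^{-1}_t}\qquad(u\in L^2,\ t\in\mathbb R).$$ There is an absolute constant $C_2\in[e^{-\pi},e^{\pi}]$ such that (i) holds for all $a<b$ and all $k\in2\pi(\mathbb Z\setminus\{0\})$, and for every $(r_1,r_2,U)$ as above there is a constant $C>0$ such that (ii) holds for all $k\in2\pi(\mathbb Z\setminus\{0\})$. **Theorem ($L^2$ stability).** Let $C_2>0$ and $C>0$ be any constants for which (i) and (ii)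 hold for the given $k$, and suppose that there is $\delta>0$ with $$|k|^{-1}\big(\|h\|_{L^\infty}+|k|^{-1}\|\partial_yh\|_{L^\infty}\big)\le\frac1C\Big(\frac1{C_2}-\delta\Big).$$ Then for every solution $W$ of Euler's equations in scattering formulation on a nondegenerate time interval $J\subset\mathbb R$, the functional $I(t)=\langle W(t),A(t)W(t)\rangle_{L^2}$ is differentiable and non-increasing on $J$, and $$\frac{d}{dt}I(t)\le-\delta\,\|W(t)\|_{\tilde H^{-1}_t}\|A(t)W(t)\|_{\tilde H^{-1}_t}\le0\qquad(t\in J).$$ In particular, if $0\in J$ and $\omega_0=W(0)$, then for all $t\in J$ with $t\ge0$ $$e^{-\pi}\|W(t)\|_{L^2}^2\le I(t)\le I(0)\le e^{\pi}\|\omega_0\|_{L^2}^2,\qquad\text{so that}\qquad \|W(t)\|_{L^2}\le e^{\pi}\|\omega_0\|_{L^2}.$$ -/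

import Mathlib

open MeasureTheory Set
open scoped ENNReal NNReal

noncomputable section

namespace EulerScattering

/-! ### Function spaces on the interval `[a, b]` -/

/-- Lebesgue measure on `[a, b]` (one endpoint is left out, which changes nothing). -/
abbrev intervalMeasure (a b : ℝ) : Measure ℝ := volume.restrict (Ioc a b)

/-- The complex Hilbert space `L²([a, b])`. -/
abbrev L2 (a b : ℝ) : Type := Lp ℂ 2 (intervalMeasure a b)

/-- `u ∈ H¹([a, b])`, through the continuous representative: `u` is the primitive on `[a, b]` of
its almost everywhere defined derivative, which lies in `L²`. -/
def IsH1 (a b : ℝ) (u : ℝ → ℂ) : Prop :=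
  MemLp (deriv u) 2 (intervalMeasure a b) ∧
    ∀ y ∈ Icc a b, u y = u a + ∫ s in a..y, deriv u s

/-- `u ∈ H¹₀([a, b])`. -/
def IsH10 (a b : ℝ) (u : ℝ → ℂ) : Prop :=
  IsH1 a b u ∧ u a = 0 ∧ u b = 0

/-- The shifted derivative `(∂_y / k - i t) u`. -/
def shiftedDeriv (k t : ℝ) (u : ℝ → ℂ) : ℝ → ℂ :=
  fun y => deriv u y / (k : ℂ) - Complex.I * (t : ℂ) * u y

/-- The `H̃¹_t` energy norm,
`‖u‖² = ‖u‖²_{L²} + ‖(∂_y / k - i t) u‖²_{L²}`. -/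
def hTildeNorm (a b k t : ℝ) (u : ℝ → ℂ) : ℝ :=
  Real.sqrt ((∫ y in a..b, ‖u y‖ ^ 2) + ∫ y in a..b, ‖shiftedDeriv k t u y‖ ^ 2)

/-- `ψ` solves `(-1 + (∂_y / k - i t)²) ψ = v` in `L²([a, b])` with `ψ = 0` at `a` and `b`.
The function `q` is the `H¹` representative of `(∂_y / k - i t) ψ`. -/
def IsDirichletPotential (a b k t : ℝ) (v ψ : ℝ → ℂ) : Prop :=
  IsH10 a b ψ ∧
    ∃ q : ℝ → ℂ, IsH1 a b q ∧
      (∀ᵐ y ∂(intervalMeasure a b), q y = shiftedDeriv k t ψ y) ∧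
      (∀ᵐ y ∂(intervalMeasure a b), -ψ y + shiftedDeriv k t q y = v y)

/-- `Ψ_t[v]`, the solution of `(-1 + (∂_y / k - i t)²) Ψ = v` with zero boundary values
(it exists, and is unique as a function on `[a, b]`, for every `v ∈ L²`). -/
def dirichletPotential (a b k t : ℝ) (v : ℝ → ℂ) : ℝ → ℂ :=
  Classical.epsilon (IsDirichletPotential a b k t v)

/-- The `H̃^{-1}_t` energy norm, `‖v‖_{H̃^{-1}_t} = ‖Ψ_t[v]‖_{H̃¹_t}`. -/
def hTildeNegNorm (a b k t : ℝ) (v : ℝ → ℂ) : ℝ :=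
  hTildeNorm a b k t (dirichletPotential a b k t v)

/-! ### The Fourier weight -/

/-- The frequencies `n ∈ (2π / (b - a)) ℤ`. -/
def freq (a b : ℝ) (m : ℤ) : ℝ := 2 * Real.pi * m / (b - a)

/-- The function `y ↦ (b - a)^{-1/2} e^{i n y}` with `n = freq a b m`. -/
def modeFun (a b : ℝ) (m : ℤ) : ℝ → ℂ :=
  fun y => Complex.exp (Complex.I * ((freq a b m * y : ℝ) : ℂ)) / ((Real.sqrt (b - a) : ℝ) : ℂ)

theorem memLp_modeFun (a b : ℝ) (m : ℤ) : MemLp (modeFun a b m) 2 (intervalMeasure a b) := by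
  have hc : Continuous (modeFun a b m) := by
    unfold modeFun
    fun_prop
  refine MemLp.of_bound hc.aestronglyMeasurable (1 / Real.sqrt (b - a)) ?_
  refine Filter.Eventually.of_forall fun y => ?_
  unfold modeFun
  rw [norm_div, mul_comm Complex.I, Complex.norm_exp_ofReal_mul_I, Complex.norm_real,
    Real.norm_of_nonneg (Real.sqrt_nonneg _)]

/-- The orthonormal Fourier basis of `L²([a, b])`. -/
def mode (a b : ℝ) (m : ℤ) : L2 a b := (memLp_modeFun a b m).toLp

/-- The weight `A(t)`: the Fourier multiplier `exp (arctan (n / k - t))`, that is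
`A(t) ∑ uₙ eₙ = ∑ exp (arctan (n / k - t)) uₙ eₙ`. -/
def weightOp (a b k t : ℝ) (u : L2 a b) : L2 a b :=
  ∑' m : ℤ, (((Real.exp (Real.arctan (freq a b m / k - t)) : ℝ) : ℂ) *
    inner ℂ (mode a b m) u) • mode a b m

/-- The quadratic form `⟨u, A(t) u⟩` (a real number, since `A(t)` is symmetric). -/
def weightForm (a b k t : ℝ) (u : L2 a b) : ℝ :=
  (inner ℂ u (weightOp a b k t u)).re

/-- `C₂` satisfies `‖u‖_{H̃^{-1}_t} ‖A(t) u‖_{H̃^{-1}_t} ≤ -C₂ ⟨u, Ȧ(t) u⟩` for all `u` and `t`,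
where `⟨u, Ȧ(t) u⟩` is the time derivative of `⟨u, A(t) u⟩` for fixed `u`. -/
def IsWeightConstant (a b k C₂ : ℝ) : Prop :=
  ∀ (t : ℝ) (u : L2 a b),
    hTildeNegNorm a b k t u * hTildeNegNorm a b k t (weightOp a b k t u) ≤
      -C₂ * deriv (fun s => weightForm a b k s u) t

/-! ### The angular velocity and the scattering formulation -/

/-- Wave numbers `k ∈ 2π (ℤ \ {0})`. -/
def IsWaveNumber (k : ℝ) : Prop := ∃ m : ℤ, m ≠ 0 ∧ k = 2 * Real.pi * m

/-- `U : [r₁, r₂] → ℝ`, `0 < r₁ < r₂`, is strictly monotone, with a Lipschitz continuous derivative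
that has no zero; so `U` is bilipschitz and `g = U' ∘ U⁻¹` is in `W^{1,∞}`. -/
structure IsAngularVelocity (r₁ r₂ : ℝ) (U : ℝ → ℝ) : Prop where
  pos : 0 < r₁
  lt : r₁ < r₂
  strictMono_or_strictAnti : StrictMonoOn U (Icc r₁ r₂) ∨ StrictAntiOn U (Icc r₁ r₂)
  differentiableOn : DifferentiableOn ℝ U (Icc r₁ r₂)
  lipschitz_deriv : ∃ K : ℝ≥0, LipschitzOnWith K (derivWithin U (Icc r₁ r₂)) (Icc r₁ r₂)
  deriv_ne_zero : ∀ r ∈ Icc r₁ r₂, derivWithin U (Icc r₁ r₂) r ≠ 0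

/-- Left endpoint `a` of the range `[a, b]` of `U`. -/
def leftEnd (r₁ r₂ : ℝ) (U : ℝ → ℝ) : ℝ := min (U r₁) (U r₂)

/-- Right endpoint `b` of the range `[a, b]` of `U`. -/
def rightEnd (r₁ r₂ : ℝ) (U : ℝ → ℝ) : ℝ := max (U r₁) (U r₂)

/-- `r(y) = U⁻¹(y)`. -/
def radius (r₁ r₂ : ℝ) (U : ℝ → ℝ) (y : ℝ) : ℝ := Function.invFunOn U (Icc r₁ r₂) y

/-- `g(y) = U'(U⁻¹(y))`. -/
def gCoeff (r₁ r₂ : ℝ) (U : ℝ → ℝ) (y : ℝ) : ℝ :=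
  derivWithin U (Icc r₁ r₂) (radius r₁ r₂ U y)

/-- `Φ = L_t w`: the function `Φ` solves
`((g (∂_y / k - i t))² + g / (k r) (∂_y / k - i t) - 1 / r²) Φ = w` in `L²([a, b])` with `Φ = 0` at
`a` and `b`. The function `p` is the `H¹` representative of `g (∂_y / k - i t) Φ`. -/
def IsStreamFunction (a b : ℝ) (g r : ℝ → ℝ) (k t : ℝ) (w Φ : ℝ → ℂ) : Prop :=
  IsH10 a b Φ ∧
    ∃ p : ℝ → ℂ, IsH1 a b p ∧
      (∀ᵐ y ∂(intervalMeasure a b), p y = (g y : ℂ) * shiftedDeriv k t Φ y) ∧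
      (∀ᵐ y ∂(intervalMeasure a b),
        (g y : ℂ) * shiftedDeriv k t p y
          + (g y : ℂ) / ((k : ℂ) * (r y : ℂ)) * shiftedDeriv k t Φ y
          - 1 / (r y : ℂ) ^ 2 * Φ y = w y)

/-- `K` satisfies `‖L_t w‖_{H̃¹_t} ≤ K ‖w‖_{H̃^{-1}_t}` for all `w ∈ L²` and all `t`. -/
def IsEllipticConstant (a b : ℝ) (g r : ℝ → ℝ) (k K : ℝ) : Prop :=
  ∀ (t : ℝ) (w : L2 a b) (Φ : ℝ → ℂ), IsStreamFunction a b g r k t w Φ →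
    hTildeNorm a b k t Φ ≤ K * hTildeNegNorm a b k t w

/-- `W` solves Euler's equations in scattering formulation, `∂_t W = (i h / k) L_t W` in
`L²([a, b])`, on the time interval `J`. -/
def IsScatteringSolution (a b : ℝ) (g r : ℝ → ℝ) (h : ℝ → ℂ) (k : ℝ) (J : Set ℝ)
    (W : ℝ → L2 a b) : Prop :=
  ∀ t ∈ J, ∃ (Φ : ℝ → ℂ) (V : L2 a b),
    IsStreamFunction a b g r k t (W t) Φ ∧
      (∀ᵐ y ∂(intervalMeasure a b), V y = Complex.I * h y / (k : ℂ) * Φ y) ∧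
      HasDerivWithinAt W V J t

/-- The `L^∞([a, b])` norm. -/
def supNorm (a b : ℝ) (f : ℝ → ℂ) : ℝ := (eLpNorm f ∞ (intervalMeasure a b)).toReal

end EulerScattering

end

open EulerScattering

/-! Differentiating `I = ⟨W, A W⟩` gives `⟨W, Ȧ W⟩ + 2 Re ⟨∂ₜW, A W⟩`. The first term is
dissipation, the second is forcing, and the smallness of `h` makes the dissipation win.

Dissipation: the symbol `exp (arctan (n/k - t))` decreases in `t`, and its derivative is minus the
symbol divided by `1 + (n/k - t)²`. Up to a factor `exp (π/2)` this is the symbol of the squared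
periodic `H̃⁻¹` norm. The Dirichlet version of that norm is no larger: functions in `H¹₀` satisfy
Parseval's identity for the energy norm without boundary terms, so their energy is the periodic one,
and duality reverses the comparison (`sq_hTildeNegNorm_le_tsum`). Inequality (i) follows with `C₂ =
exp (π/2)`.

Forcing: `∂ₜW = (i h / k) Φ` vanishes at the boundary, so it can be paired with `A W` in the duality
between `H¹₀` and `H̃⁻¹`. Multiplication by `h` costs `‖h‖ + |k|⁻¹ ‖h'‖` in the energy norm
(`hTildeNorm_mul_le`, `norm_inner_forcing_le`), and (ii) bounds `Φ` by `W`.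

Inequality (ii) comes from testing the stream function equation with `(r/g) Φ`. Because `r' = 1/g`,
the first order terms cancel. What remains is `∫ r g |DΦ|² + |Φ|²/(r g)`, whose integrand has the
sign of `g` and is coercive uniformly in `k` and `t`. -/

namespace EulerScattering

/-! ### Absolutely continuous functions with complex values -/

section AbsolutelyContinuous

variable {a b : ℝ}

/-- Real part, imaginary part, conjugation and the embedding of `ℝ` in `ℂ` are all 1-Lipschitz, so
this transfers absolute continuity between a complex function and its components. -/
theorem _root_.LipschitzWith.comp_absolutelyContinuousOnInterval {X Y : Type*}
    [PseudoMetricSpace X] [PseudoMetricSpace Y] {F : X → Y} {K : ℝ≥0} (hF : LipschitzWith K F)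
    {u : ℝ → X} (hu : AbsolutelyContinuousOnInterval u a b) :
    AbsolutelyContinuousOnInterval (fun y => F (u y)) a b := by
  have h : Filter.Tendsto (fun E : ℕ × (ℕ → ℝ × ℝ) =>
      (K : ℝ) * ∑ i ∈ Finset.range E.1, dist (u (E.2 i).1) (u (E.2 i).2))
      (AbsolutelyContinuousOnInterval.totalLengthFilter ⊓
        Filter.principal (AbsolutelyContinuousOnInterval.disjWithin a b)) (nhds 0) := by
    simpa using Filter.Tendsto.const_mul (K : ℝ) hu
  refine squeeze_zero (fun E => Finset.sum_nonneg fun _ _ => dist_nonneg) (fun E => ?_) h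
  rw [Finset.mul_sum]
  exact Finset.sum_le_sum fun i _ => hF.dist_le_mul _ _

theorem _root_.AbsolutelyContinuousOnInterval.congr {X : Type*} [PseudoMetricSpace X]
    {u v : ℝ → X} (hu : AbsolutelyContinuousOnInterval u a b) (h : EqOn u v (uIcc a b)) :
    AbsolutelyContinuousOnInterval v a b := by
  rw [absolutelyContinuousOnInterval_iff] at hu ⊢
  intro ε hε
  obtain ⟨δ, hδ, H⟩ := hu ε hε
  refine ⟨δ, hδ, fun E hE hlt => ?_⟩
  convert H E hE hlt using 2 with i hi
  rw [h (hE.1 i hi).1, h (hE.1 i hi).2]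

theorem absolutelyContinuousOnInterval_of_re_im {u : ℝ → ℂ}
    (hr : AbsolutelyContinuousOnInterval (fun y => (u y).re) a b)
    (hi : AbsolutelyContinuousOnInterval (fun y => (u y).im) a b) :
    AbsolutelyContinuousOnInterval u a b := by
  have h1 := Complex.isometry_ofReal.lipschitz.comp_absolutelyContinuousOnInterval hr
  have h2 := (Complex.isometry_ofReal.lipschitz.comp_absolutelyContinuousOnInterval hi).const_smul
    Complex.I
  refine (h1.add h2).congr fun y _ => ?_
  simp only [Pi.add_apply, smul_eq_mul]
  rw [mul_comm, Complex.re_add_im]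

theorem _root_.AbsolutelyContinuousOnInterval.re {u : ℝ → ℂ}
    (hu : AbsolutelyContinuousOnInterval u a b) :
    AbsolutelyContinuousOnInterval (fun y => (u y).re) a b :=
  (LipschitzWith.of_dist_le_mul (K := 1) fun x y => by
    rw [Real.dist_eq, Complex.dist_eq, ← Complex.sub_re, NNReal.coe_one, one_mul]
    exact Complex.abs_re_le_norm _).comp_absolutelyContinuousOnInterval hu

theorem _root_.AbsolutelyContinuousOnInterval.im {u : ℝ → ℂ}
    (hu : AbsolutelyContinuousOnInterval u a b) :
    AbsolutelyContinuousOnInterval (fun y => (u y).im) a b :=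
  (LipschitzWith.of_dist_le_mul (K := 1) fun x y => by
    rw [Real.dist_eq, Complex.dist_eq, ← Complex.sub_im, NNReal.coe_one, one_mul]
    exact Complex.abs_im_le_norm _).comp_absolutelyContinuousOnInterval hu

theorem hasDerivAt_of_re_im {u : ℝ → ℂ} {x p q : ℝ} (hr : HasDerivAt (fun y => (u y).re) p x)
    (hi : HasDerivAt (fun y => (u y).im) q x) : HasDerivAt u (p + q * Complex.I) x := by
  have h := hr.ofReal_comp.add (hi.ofReal_comp.mul_const Complex.I)
  refine h.congr_of_eventuallyEq (Filter.Eventually.of_forall fun y => ?_)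
  simp [Complex.re_add_im]

/-- A complex absolutely continuous function has a derivative almost everywhere, with the expected
real and imaginary parts. -/
theorem ae_hasDerivAt_of_absolutelyContinuous {u : ℝ → ℂ}
    (hu : AbsolutelyContinuousOnInterval u a b) :
    ∀ᵐ x, x ∈ uIcc a b → HasDerivAt u (((deriv (fun y => (u y).re) x : ℝ) : ℂ) +
      ((deriv (fun y => (u y).im) x : ℝ) : ℂ) * Complex.I) x := by
  filter_upwards [hu.re.ae_differentiableAt, hu.im.ae_differentiableAt] with x h1 h2 hx
  exact hasDerivAt_of_re_im (h1 hx).hasDerivAt (h2 hx).hasDerivAt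

theorem ae_restrict_of_uIcc {p : ℝ → Prop} (hab : a ≤ b) (h : ∀ᵐ x, x ∈ uIcc a b → p x) :
    ∀ᵐ x ∂(intervalMeasure a b), p x := by
  rw [ae_restrict_iff' measurableSet_Ioc]
  filter_upwards [h] with x hx hx'
  exact hx (by rw [uIcc_of_le hab]; exact Ioc_subset_Icc_self hx')

theorem ae_differentiableAt_of_absolutelyContinuous {u : ℝ → ℂ} (hab : a ≤ b)
    (hu : AbsolutelyContinuousOnInterval u a b) :
    ∀ᵐ x ∂(intervalMeasure a b), DifferentiableAt ℝ u x := by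
  refine ae_restrict_of_uIcc hab ?_
  filter_upwards [ae_hasDerivAt_of_absolutelyContinuous hu] with x h hx
  exact (h hx).differentiableAt

theorem integrable_deriv_of_absolutelyContinuous {u : ℝ → ℂ} (hab : a ≤ b)
    (hu : AbsolutelyContinuousOnInterval u a b) :
    Integrable (deriv u) (intervalMeasure a b) := by
  have h1 := (intervalIntegrable_iff_integrableOn_Ioc_of_le hab).1 hu.re.intervalIntegrable_deriv
  have h2 := (intervalIntegrable_iff_integrableOn_Ioc_of_le hab).1 hu.im.intervalIntegrable_deriv
  refine (h1.ofReal (𝕜 := ℂ)).add ((h2.ofReal (𝕜 := ℂ)).mul_const Complex.I) |>.congr ?_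
  filter_upwards [ae_restrict_of_uIcc hab (ae_hasDerivAt_of_absolutelyContinuous hu)] with x hx
  simp [hx.deriv]

/-- The real fundamental theorem of calculus, applied to both components. -/
theorem integral_deriv_of_absolutelyContinuous {u : ℝ → ℂ}
    (hu : AbsolutelyContinuousOnInterval u a b) :
    ∫ x in a..b, deriv u x = u b - u a := by
  have h1 := hu.re.intervalIntegrable_deriv
  have h2 := hu.im.intervalIntegrable_deriv
  have h1' : IntervalIntegrable (fun x => ((deriv (fun y => (u y).re) x : ℝ) : ℂ)) volume a b :=
    ⟨h1.1.ofReal, h1.2.ofReal⟩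
  have h2' : IntervalIntegrable (fun x => ((deriv (fun y => (u y).im) x : ℝ) : ℂ)) volume a b :=
    ⟨h2.1.ofReal, h2.2.ofReal⟩
  have e : ∫ x in a..b, deriv u x = ∫ x in a..b, ((((deriv (fun y => (u y).re) x : ℝ) : ℂ) +
      ((deriv (fun y => (u y).im) x : ℝ) : ℂ) * Complex.I)) := by
    refine intervalIntegral.integral_congr_ae ?_
    filter_upwards [ae_hasDerivAt_of_absolutelyContinuous hu] with x hx hx'
    exact (hx (uIoc_subset_uIcc hx')).deriv
  rw [e, intervalIntegral.integral_add h1' (h2'.mul_const _),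
    intervalIntegral.integral_mul_const, intervalIntegral.integral_ofReal,
    intervalIntegral.integral_ofReal, hu.re.integral_deriv_eq_sub, hu.im.integral_deriv_eq_sub]
  apply Complex.ext <;> simp

/-- The primitive of an integrable function is absolutely continuous. -/
theorem absolutelyContinuous_integral {f : ℝ → ℂ} (hab : a ≤ b)
    (hf : Integrable f (intervalMeasure a b)) :
    AbsolutelyContinuousOnInterval (fun y => ∫ s in a..y, f s) a b := by
  have hi : IntervalIntegrable f volume a b :=
    (intervalIntegrable_iff_integrableOn_Ioc_of_le hab).2 hf
  have hsub : ∀ y ∈ uIcc a b, IntervalIntegrable f volume a y := fun y hy =>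
    hi.mono_set (uIcc_subset_uIcc_left hy)
  have hr : IntervalIntegrable (fun y => (f y).re) volume a b :=
    (intervalIntegrable_iff_integrableOn_Ioc_of_le hab).2 (Integrable.re hf)
  have him : IntervalIntegrable (fun y => (f y).im) volume a b :=
    (intervalIntegrable_iff_integrableOn_Ioc_of_le hab).2 (Integrable.im hf)
  refine absolutelyContinuousOnInterval_of_re_im ?_ ?_
  · refine (hr.absolutelyContinuousOnInterval_intervalIntegral (c := a) (by simp)).congr
      fun y hy => ?_
    exact (Complex.reCLM.intervalIntegral_comp_comm (hsub y hy))
  · refine (him.absolutelyContinuousOnInterval_intervalIntegral (c := a) (by simp)).congr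
      fun y hy => ?_
    exact (Complex.imCLM.intervalIntegral_comp_comm (hsub y hy))

theorem absolutelyContinuous_conj {u : ℝ → ℂ} (hu : AbsolutelyContinuousOnInterval u a b) :
    AbsolutelyContinuousOnInterval (fun y => star (u y)) a b :=
  (starₗᵢ ℂ : ℂ ≃ₗᵢ⋆[ℂ] ℂ).isometry.lipschitz.comp_absolutelyContinuousOnInterval hu

/-- Integration by parts for complex absolutely continuous functions. -/
theorem integral_deriv_mul_of_absolutelyContinuous {u v : ℝ → ℂ} (hab : a ≤ b)
    (hu : AbsolutelyContinuousOnInterval u a b) (hv : AbsolutelyContinuousOnInterval v a b) :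
    ∫ x, (deriv u x * v x + u x * deriv v x) ∂(intervalMeasure a b) = u b * v b - u a * v a := by
  have h := integral_deriv_of_absolutelyContinuous (hu.smul hv)
  simp only [Pi.smul_apply', smul_eq_mul] at h
  rw [← h, intervalIntegral.integral_of_le hab]
  refine integral_congr_ae ?_
  filter_upwards [ae_differentiableAt_of_absolutelyContinuous hab hu,
    ae_differentiableAt_of_absolutelyContinuous hab hv] with x h1 h2
  exact (h1.hasDerivAt.mul h2.hasDerivAt).deriv.symm

theorem memLp_top_of_absolutelyContinuous {u : ℝ → ℂ} (hab : a ≤ b)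
    (hu : AbsolutelyContinuousOnInterval u a b) : MemLp u ∞ (intervalMeasure a b) := by
  obtain ⟨C, hC⟩ := hu.exists_bound
  rw [uIcc_of_le hab] at hC
  refine memLp_top_of_bound ?_ C ?_
  · have := hu.continuousOn
    rw [uIcc_of_le hab] at this
    exact (this.mono Ioc_subset_Icc_self).aestronglyMeasurable measurableSet_Ioc
  · rw [ae_restrict_iff' measurableSet_Ioc]
    exact Filter.Eventually.of_forall fun x hx => hC x (Ioc_subset_Icc_self hx)

end AbsolutelyContinuous

/-! ### The space `H¹` -/

section Sobolev

variable {a b : ℝ}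

/-- Trades the primitive formula for absolute continuity, which is visibly stable under sums,
products and Lipschitz maps. -/
theorem isH1_iff {u : ℝ → ℂ} (hab : a ≤ b) :
    IsH1 a b u ↔ AbsolutelyContinuousOnInterval u a b ∧
      MemLp (deriv u) 2 (intervalMeasure a b) := by
  constructor
  · rintro ⟨h1, h2⟩
    refine ⟨?_, h1⟩
    have hc : AbsolutelyContinuousOnInterval (fun _ : ℝ => u a) a b :=
      (LipschitzWith.const (u a)).lipschitzOnWith.absolutelyContinuousOnInterval
    refine (hc.add (absolutelyContinuous_integral hab (h1.integrable one_le_two))).congr ?_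
    intro y hy
    rw [uIcc_of_le hab] at hy
    simp [h2 y hy]
  · rintro ⟨h1, h2⟩
    refine ⟨h2, fun y hy => ?_⟩
    have : AbsolutelyContinuousOnInterval u a y :=
      h1.mono (by rw [uIcc_of_le hab, uIcc_of_le hy.1]; exact Icc_subset_Icc_right hy.2)
    rw [integral_deriv_of_absolutelyContinuous this]
    ring

theorem IsH1.absolutelyContinuous {u : ℝ → ℂ} (hab : a ≤ b) (h : IsH1 a b u) :
    AbsolutelyContinuousOnInterval u a b := ((isH1_iff hab).1 h).1

theorem IsH1.memLp {u : ℝ → ℂ} (hab : a ≤ b) (h : IsH1 a b u) :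
    MemLp u 2 (intervalMeasure a b) :=
  (memLp_top_of_absolutelyContinuous hab (h.absolutelyContinuous hab)).mono_exponent le_top

theorem memLp_shiftedDeriv {u : ℝ → ℂ} (hab : a ≤ b) (h : IsH1 a b u) (k t : ℝ) :
    MemLp (shiftedDeriv k t u) 2 (intervalMeasure a b) := by
  have h1 : MemLp (fun y => deriv u y / (k : ℂ)) 2 (intervalMeasure a b) := by
    simpa [div_eq_inv_mul] using h.1.const_mul ((k : ℂ)⁻¹)
  exact h1.sub ((h.memLp hab).const_mul (Complex.I * t))

/-- The product of an `H¹` function with an absolutely continuous function whose derivative is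
square integrable. -/
theorem IsH1.mul {u v : ℝ → ℂ} (hab : a ≤ b) (hu : IsH1 a b u) (hv : IsH1 a b v) :
    IsH1 a b (fun y => u y * v y) := by
  have hu' := hu.absolutelyContinuous hab
  have hv' := hv.absolutelyContinuous hab
  refine (isH1_iff hab).2 ⟨hu'.smul hv', ?_⟩
  have h1 : MemLp (fun y => deriv u y * v y) 2 (intervalMeasure a b) :=
    (memLp_top_of_absolutelyContinuous hab hv').mul hu.1
  have h2 : MemLp (fun y => u y * deriv v y) 2 (intervalMeasure a b) :=
    hv.1.mul (memLp_top_of_absolutelyContinuous hab hu')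
  refine (h1.add h2).ae_eq ?_
  filter_upwards [ae_differentiableAt_of_absolutelyContinuous hab hu',
    ae_differentiableAt_of_absolutelyContinuous hab hv'] with x e1 e2
  exact (e1.hasDerivAt.mul e2.hasDerivAt).deriv.symm

/-- Discards the endpoint `b`, where `deriv` depends on values outside `[a, b]`. -/
theorem ae_mem_Ioo (a b : ℝ) : ∀ᵐ y ∂(intervalMeasure a b), y ∈ Ioo a b := by
  rw [ae_restrict_iff' measurableSet_Ioc]
  filter_upwards [compl_mem_ae_iff.2 (measure_singleton (μ := volume) b)] with y hy hy'
  exact ⟨hy'.1, lt_of_le_of_ne hy'.2 hy⟩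

theorem ae_norm_deriv_le_of_lipschitzOnWith {m : ℝ → ℂ} {K : ℝ≥0}
    (hm : LipschitzOnWith K m (Icc a b)) :
    ∀ᵐ y ∂(intervalMeasure a b), ‖deriv m y‖ ≤ K := by
  filter_upwards [ae_mem_Ioo a b] with y hy
  exact norm_deriv_le_of_lipschitzOn (Icc_mem_nhds hy.1 hy.2) hm

theorem isH1_of_lipschitzOnWith {m : ℝ → ℂ} {K : ℝ≥0} (hab : a ≤ b)
    (hm : LipschitzOnWith K m (Icc a b)) : IsH1 a b m := by
  have hac : AbsolutelyContinuousOnInterval m a b :=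
    LipschitzOnWith.absolutelyContinuousOnInterval (K := K) (by rwa [uIcc_of_le hab])
  exact (isH1_iff hab).2 ⟨hac, MemLp.of_bound
    (integrable_deriv_of_absolutelyContinuous hab hac).aestronglyMeasurable K
    (ae_norm_deriv_le_of_lipschitzOnWith hm)⟩

theorem IsH10.mul_left {m u : ℝ → ℂ} (hab : a ≤ b) (hm : IsH1 a b m) (hu : IsH10 a b u) :
    IsH10 a b (fun y => m y * u y) :=
  ⟨hm.mul hab hu.1, by simp [hu.2.1], by simp [hu.2.2]⟩

/-- The product rule for the shifted derivative. -/
theorem shiftedDeriv_mul {m u : ℝ → ℂ} (hab : a ≤ b) (hm : IsH1 a b m) (hu : IsH1 a b u)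
    (k t : ℝ) :
    ∀ᵐ y ∂(intervalMeasure a b), shiftedDeriv k t (fun y => m y * u y) y =
      m y * shiftedDeriv k t u y + deriv m y / (k : ℂ) * u y := by
  filter_upwards [ae_differentiableAt_of_absolutelyContinuous hab (hm.absolutelyContinuous hab),
    ae_differentiableAt_of_absolutelyContinuous hab (hu.absolutelyContinuous hab)] with x e1 e2
  have e := (e1.hasDerivAt.mul e2.hasDerivAt).deriv
  simp only [shiftedDeriv]
  erw [e]
  ring

/-- The product of two square integrable functions, one of them conjugated, is integrable. -/
theorem integrable_conj_mul {u v : ℝ → ℂ} (hu : MemLp u 2 (intervalMeasure a b))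
    (hv : MemLp v 2 (intervalMeasure a b)) :
    Integrable (fun y => star (u y) * v y) (intervalMeasure a b) :=
  MemLp.integrable_mul (p := 2) (q := 2) hu.star hv

/-- The shifted derivative is skew-symmetric against functions with zero boundary values. -/
theorem integral_conj_mul_shiftedDeriv {φ q : ℝ → ℂ} (hab : a ≤ b) (hφ : IsH10 a b φ)
    (hq : IsH1 a b q) (k t : ℝ) :
    ∫ y, star (φ y) * shiftedDeriv k t q y ∂(intervalMeasure a b) =
      -∫ y, star (shiftedDeriv k t φ y) * q y ∂(intervalMeasure a b) := by
  have hφ' := hφ.1.absolutelyContinuous hab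
  have hibp := integral_deriv_mul_of_absolutelyContinuous hab (absolutelyContinuous_conj hφ')
    (hq.absolutelyContinuous hab)
  rw [hφ.2.1, hφ.2.2] at hibp
  rw [eq_neg_iff_add_eq_zero, ← integral_add
    (integrable_conj_mul (hφ.1.memLp hab) (memLp_shiftedDeriv hab hq k t))
    (integrable_conj_mul (memLp_shiftedDeriv hab hφ.1 k t) (hq.memLp hab))]
  -- The two `i t` terms cancel, since conjugation flips the sign of one of them; what is left is
  -- `k⁻¹` times the derivative of `star φ * q`.
  have : ∫ x, (k : ℂ)⁻¹ * (deriv (fun y => star (φ y)) x * q x + star (φ x) * deriv q x)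
      ∂(intervalMeasure a b) = 0 := by
    rw [integral_const_mul, hibp]
    simp
  rw [← this]
  refine integral_congr_ae ?_
  filter_upwards [ae_differentiableAt_of_absolutelyContinuous hab hφ'] with x hx
  rw [hx.hasDerivAt.star.deriv]
  simp only [shiftedDeriv, star_sub, star_mul', star_div₀, Complex.star_def, Complex.conj_ofReal,
    Complex.conj_I]
  ring

end Sobolev

/-! ### The energy norm as a Hilbert space norm -/

section Energy

variable {a b : ℝ}

theorem norm_toLp_sq {f : ℝ → ℂ} (hf : MemLp f 2 (intervalMeasure a b)) :
    ‖hf.toLp f‖ ^ 2 = ∫ y, ‖f y‖ ^ 2 ∂(intervalMeasure a b) := by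
  have h : (inner ℂ (hf.toLp f) (hf.toLp f) : ℂ) =
      ((∫ y, ‖f y‖ ^ 2 ∂(intervalMeasure a b) : ℝ) : ℂ) := by
    rw [L2.inner_def, ← integral_complex_ofReal]
    refine integral_congr_ae ?_
    filter_upwards [hf.coeFn_toLp] with y hy
    rw [hy, inner_self_eq_norm_sq_to_K]
    simp
  rw [inner_self_eq_norm_sq_to_K] at h
  refine Complex.ofReal_injective (Eq.trans ?_ h)
  push_cast
  rfl

theorem inner_toLp {f g : ℝ → ℂ} (hf : MemLp f 2 (intervalMeasure a b))
    (hg : MemLp g 2 (intervalMeasure a b)) :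
    (inner ℂ (hf.toLp f) (hg.toLp g) : ℂ) = ∫ y, star (f y) * g y ∂(intervalMeasure a b) := by
  rw [L2.inner_def]
  refine integral_congr_ae ?_
  filter_upwards [hf.coeFn_toLp, hg.coeFn_toLp] with y h1 h2
  rw [h1, h2, RCLike.inner_apply, mul_comm]
  rfl

theorem inner_eq_integral (u v : L2 a b) :
    (inner ℂ u v : ℂ) = ∫ y, star (u y) * v y ∂(intervalMeasure a b) := by
  rw [L2.inner_def]
  refine integral_congr_ae (Filter.Eventually.of_forall fun y => ?_)
  simp only [RCLike.inner_apply]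
  exact mul_comm _ _

/-- Realises the energy norm of `u` as the norm of the pair `(u, D u)` in the Hilbert sum, so that
Cauchy–Schwarz and the triangle inequality come for free. -/
theorem norm_pair {f g : ℝ → ℂ} (hf : MemLp f 2 (intervalMeasure a b))
    (hg : MemLp g 2 (intervalMeasure a b)) :
    ‖(WithLp.toLp 2 (hf.toLp f, hg.toLp g) : WithLp 2 (L2 a b × L2 a b))‖ =
      Real.sqrt ((∫ y, ‖f y‖ ^ 2 ∂(intervalMeasure a b)) +
        ∫ y, ‖g y‖ ^ 2 ∂(intervalMeasure a b)) := by
  rw [WithLp.prod_norm_eq_of_L2]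
  change Real.sqrt (‖hf.toLp f‖ ^ 2 + ‖hg.toLp g‖ ^ 2) = _
  rw [norm_toLp_sq, norm_toLp_sq]

theorem hTildeNorm_eq (hab : a ≤ b) (k t : ℝ) (u : ℝ → ℂ) :
    hTildeNorm a b k t u = Real.sqrt ((∫ y, ‖u y‖ ^ 2 ∂(intervalMeasure a b)) +
        ∫ y, ‖shiftedDeriv k t u y‖ ^ 2 ∂(intervalMeasure a b)) := by
  rw [hTildeNorm, intervalIntegral.integral_of_le hab, intervalIntegral.integral_of_le hab]

theorem hTildeNorm_nonneg (a b k t : ℝ) (u : ℝ → ℂ) : 0 ≤ hTildeNorm a b k t u :=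
  Real.sqrt_nonneg _

theorem hTildeNegNorm_nonneg (a b k t : ℝ) (v : ℝ → ℂ) : 0 ≤ hTildeNegNorm a b k t v :=
  Real.sqrt_nonneg _

theorem sq_hTildeNorm (hab : a ≤ b) (k t : ℝ) (u : ℝ → ℂ) :
    hTildeNorm a b k t u ^ 2 = (∫ y, ‖u y‖ ^ 2 ∂(intervalMeasure a b)) +
        ∫ y, ‖shiftedDeriv k t u y‖ ^ 2 ∂(intervalMeasure a b) := by
  rw [hTildeNorm_eq hab, Real.sq_sqrt]
  exact add_nonneg (integral_nonneg fun _ => by positivity)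
    (integral_nonneg fun _ => by positivity)

/-- The Cauchy–Schwarz inequality for the energy inner product. -/
theorem norm_energy_inner_le {φ ψ : ℝ → ℂ} (hab : a ≤ b) (hφ : IsH1 a b φ) (hψ : IsH1 a b ψ)
    (k t : ℝ) :
    ‖(∫ y, star (φ y) * ψ y ∂(intervalMeasure a b)) +
      ∫ y, star (shiftedDeriv k t φ y) * shiftedDeriv k t ψ y ∂(intervalMeasure a b)‖ ≤
      hTildeNorm a b k t φ * hTildeNorm a b k t ψ := by
  have h := norm_inner_le_norm (𝕜 := ℂ)
    (WithLp.toLp 2 ((hφ.memLp hab).toLp φ, (memLp_shiftedDeriv hab hφ k t).toLp _) :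
      WithLp 2 (L2 a b × L2 a b))
    (WithLp.toLp 2 ((hψ.memLp hab).toLp ψ, (memLp_shiftedDeriv hab hψ k t).toLp _))
  rw [norm_pair, norm_pair, ← hTildeNorm_eq hab, ← hTildeNorm_eq hab, WithLp.prod_inner_apply] at h
  simpa only [inner_toLp] using h

theorem integral_sq_le_of_ae_le {f g : ℝ → ℂ} {M : ℝ} (hf : MemLp f 2 (intervalMeasure a b))
    (h : ∀ᵐ y ∂(intervalMeasure a b), ‖g y‖ ≤ M * ‖f y‖) :
    ∫ y, ‖g y‖ ^ 2 ∂(intervalMeasure a b) ≤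
      M ^ 2 * ∫ y, ‖f y‖ ^ 2 ∂(intervalMeasure a b) := by
  rw [← integral_const_mul]
  refine integral_mono_of_nonneg (Filter.Eventually.of_forall fun _ => by positivity)
    ((hf.integrable_norm_pow two_ne_zero).const_mul _) ?_
  filter_upwards [h] with y hy
  rw [← mul_pow]
  exact pow_le_pow_left₀ (norm_nonneg _) hy 2

/-- Multiplication by a function in `W^{1,∞}` is bounded in the energy norm. -/
theorem hTildeNorm_mul_le {m u : ℝ → ℂ} {M₀ M₁ k : ℝ} (hab : a ≤ b) (hm : IsH1 a b m)
    (hu : IsH1 a b u) (t : ℝ) (hM₀ : 0 ≤ M₀) (hM₁ : 0 ≤ M₁)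
    (h₀ : ∀ᵐ y ∂(intervalMeasure a b), ‖m y‖ ≤ M₀)
    (h₁ : ∀ᵐ y ∂(intervalMeasure a b), ‖deriv m y‖ ≤ M₁) :
    hTildeNorm a b k t (fun y => m y * u y) ≤ (M₀ + |k|⁻¹ * M₁) * hTildeNorm a b k t u := by
  have hu2 := hu.memLp hab
  have hD := memLp_shiftedDeriv hab hu k t
  have hmtop := memLp_top_of_absolutelyContinuous hab (hm.absolutelyContinuous hab)
  have f0 : MemLp (fun y => m y * u y) 2 (intervalMeasure a b) := hu2.mul hmtop
  have f1 : MemLp (fun y => m y * shiftedDeriv k t u y) 2 (intervalMeasure a b) := hD.mul hmtop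
  have f2 : MemLp (fun y => deriv m y / (k : ℂ) * u y) 2 (intervalMeasure a b) := by
    have hu' := memLp_top_of_absolutelyContinuous hab (hu.absolutelyContinuous hab)
    have := hu'.mul (r := 2) (p := 2) (q := ∞) (hm.1.const_mul ((k : ℂ)⁻¹))
    simp only [div_eq_inv_mul]
    exact this
  have f3 := memLp_shiftedDeriv hab (hm.mul hab hu) k t
  have b0 : ∫ y, ‖m y * u y‖ ^ 2 ∂(intervalMeasure a b) ≤
      M₀ ^ 2 * ∫ y, ‖u y‖ ^ 2 ∂(intervalMeasure a b) :=
    integral_sq_le_of_ae_le hu2 (by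
      filter_upwards [h₀] with y hy
      rw [norm_mul]; gcongr)
  have b1 : ∫ y, ‖m y * shiftedDeriv k t u y‖ ^ 2 ∂(intervalMeasure a b) ≤
      M₀ ^ 2 * ∫ y, ‖shiftedDeriv k t u y‖ ^ 2 ∂(intervalMeasure a b) :=
    integral_sq_le_of_ae_le hD (by
      filter_upwards [h₀] with y hy
      rw [norm_mul]; gcongr)
  have b2 : ∫ y, ‖deriv m y / (k : ℂ) * u y‖ ^ 2 ∂(intervalMeasure a b) ≤
      (|k|⁻¹ * M₁) ^ 2 * ∫ y, ‖u y‖ ^ 2 ∂(intervalMeasure a b) :=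
    integral_sq_le_of_ae_le hu2 (by
      filter_upwards [h₁] with y hy
      rw [norm_mul, norm_div, Complex.norm_real, Real.norm_eq_abs, div_eq_inv_mul]; gcongr)
  -- `D (m u) = m D u + (m'/k) u`. The second summand is paired with `0`, so the triangle inequality
  -- yields exactly `M₀ + |k|⁻¹ M₁`.
  have hsplit : (WithLp.toLp 2 (f0.toLp _, f3.toLp _) : WithLp 2 (L2 a b × L2 a b)) =
      WithLp.toLp 2 (f0.toLp _, f1.toLp _) +
        WithLp.toLp 2 (MemLp.zero.toLp (0 : ℝ → ℂ), f2.toLp _) := by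
    rw [← WithLp.toLp_add, Prod.mk_add_mk, ← MemLp.toLp_add, ← MemLp.toLp_add]
    congr 2
    · exact MemLp.toLp_congr _ _ (by simp)
    · exact MemLp.toLp_congr _ _ (shiftedDeriv_mul hab hm hu k t)
  have hN : Real.sqrt (∫ y, ‖u y‖ ^ 2 ∂(intervalMeasure a b)) ≤ hTildeNorm a b k t u := by
    rw [hTildeNorm_eq hab]
    exact Real.sqrt_le_sqrt (le_add_of_nonneg_right (integral_nonneg fun _ => by positivity))
  rw [hTildeNorm_eq hab, ← norm_pair f0 f3, hsplit, add_mul]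
  refine (norm_add_le _ _).trans (add_le_add ?_ ?_)
  · rw [norm_pair, hTildeNorm_eq hab]
    calc _ ≤ Real.sqrt (M₀ ^ 2 * ((∫ y, ‖u y‖ ^ 2 ∂(intervalMeasure a b)) +
        ∫ y, ‖shiftedDeriv k t u y‖ ^ 2 ∂(intervalMeasure a b))) :=
          Real.sqrt_le_sqrt (by rw [mul_add]; exact add_le_add b0 b1)
      _ = _ := by rw [Real.sqrt_mul (by positivity), Real.sqrt_sq hM₀]
  · rw [norm_pair]
    calc _ ≤ Real.sqrt ((|k|⁻¹ * M₁) ^ 2 * ∫ y, ‖u y‖ ^ 2 ∂(intervalMeasure a b)) :=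
          Real.sqrt_le_sqrt (by simpa using b2)
      _ = |k|⁻¹ * M₁ * Real.sqrt (∫ y, ‖u y‖ ^ 2 ∂(intervalMeasure a b)) := by
          rw [Real.sqrt_mul (by positivity), Real.sqrt_sq (by positivity)]
      _ ≤ _ := by gcongr

end Energy

/-! ### The Dirichlet potential -/

section Dirichlet

variable {a b : ℝ}

theorem isH1_of_contDiff {u : ℝ → ℂ} (hab : a ≤ b) (hu : ContDiff ℝ 1 u) : IsH1 a b u := by
  obtain ⟨K, hK⟩ := hu.contDiffOn.exists_lipschitzOnWith (s := Icc a b) one_ne_zero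
    (convex_Icc _ _) isCompact_Icc
  exact isH1_of_lipschitzOnWith hab hK

theorem ae_hasDerivAt_integral {f : ℝ → ℂ} (hab : a ≤ b)
    (hf : Integrable f (intervalMeasure a b)) :
    ∀ᵐ y ∂(intervalMeasure a b), HasDerivAt (fun x => ∫ s in a..x, f s) (f y) y := by
  refine ae_restrict_of_uIcc hab ?_
  filter_upwards [((intervalIntegrable_iff_integrableOn_Ioc_of_le hab).2
    hf).ae_hasDerivAt_integral] with y hy hy'
  exact hy hy' a (by simp)

/-- Solutions of a scalar linear first order equation, with all initial values. -/
theorem exists_isH1_deriv_eq (hab : a ≤ b) (μ : ℂ) {f : ℝ → ℂ}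
    (hf : MemLp f 2 (intervalMeasure a b)) :
    ∃ β : ℂ, ∀ c : ℂ, ∃ p : ℝ → ℂ, IsH1 a b p ∧ p a = c ∧
      p b = Complex.exp (μ * (b - a)) * (c + β) ∧
      ∀ᵐ y ∂(intervalMeasure a b), DifferentiableAt ℝ p y ∧ deriv p y = μ * p y + f y := by
  let F : ℝ → ℂ := fun s => Complex.exp (-(μ * (s - a))) * f s
  have hE : ∀ ν : ℂ, IsH1 a b (fun y : ℝ => Complex.exp (ν * (y - a))) := fun ν => by
    refine isH1_of_contDiff hab ?_
    have : ContDiff ℝ 1 (fun y : ℝ => (y : ℂ)) := Complex.ofRealCLM.contDiff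
    fun_prop
  have hF : MemLp F 2 (intervalMeasure a b) := by
    have := memLp_top_of_absolutelyContinuous hab ((hE (-μ)).absolutelyContinuous hab)
    have h2 := MemLp.mul (r := 2) hf this
    simp only [neg_mul] at h2
    exact h2
  have hFi := hF.integrable one_le_two
  -- Variation of constants. The number `β` does not depend on `c`, so a boundary condition at `b`
  -- becomes a linear equation for `c`.
  refine ⟨∫ s in a..b, F s, fun c =>
    ⟨fun y => Complex.exp (μ * (y - a)) * (c + ∫ s in a..y, F s), ?_, by simp, rfl, ?_⟩⟩
  · refine (hE μ).mul hab ((isH1_iff hab).2 ⟨?_, ?_⟩)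
    · have hc : AbsolutelyContinuousOnInterval (fun _ : ℝ => c) a b :=
        (LipschitzWith.const c).lipschitzOnWith.absolutelyContinuousOnInterval
      exact hc.add (absolutelyContinuous_integral hab hFi)
    · refine hF.ae_eq ?_
      filter_upwards [ae_hasDerivAt_integral hab hFi] with y hy
      exact (hy.const_add c).deriv.symm
  · filter_upwards [ae_hasDerivAt_integral hab hFi] with y hy
    have e : HasDerivAt (fun y : ℝ => Complex.exp (μ * (y - a)))
        (Complex.exp (μ * (y - a)) * (μ * 1)) y :=
      ((((hasDerivAt_id y).ofReal_comp).sub_const (a : ℂ)).const_mul μ).cexp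
    have h := e.mul (hy.const_add c)
    refine ⟨h.differentiableAt, ?_⟩
    refine Eq.trans h.deriv ?_
    have : Complex.exp (μ * (y - a)) * F y = f y := by
      simp only [F]
      rw [← mul_assoc, ← Complex.exp_add]
      simp
    rw [this]
    ring

/-- The system `D ψ = q`, `D q = v + ψ` decouples: `p = q + ψ` and `m = q - ψ` satisfy `(D - 1) p =
v` and `(D + 1) m = v`, which are scalar first order equations. -/
theorem exists_isDirichletPotential (hab : a < b) {k : ℝ} (hk : k ≠ 0) (t : ℝ) {v : ℝ → ℂ}
    (hv : MemLp v 2 (intervalMeasure a b)) : ∃ ψ, IsDirichletPotential a b k t v ψ := by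
  have hkc : (k : ℂ) ≠ 0 := by exact_mod_cast hk
  let ℓ : ℂ := Complex.I * k * t
  obtain ⟨β₁, H₁⟩ := exists_isH1_deriv_eq hab.le (ℓ + k) (hv.const_mul (k : ℂ))
  obtain ⟨β₂, H₂⟩ := exists_isH1_deriv_eq hab.le (ℓ - k) (hv.const_mul (k : ℂ))
  set E₁ := Complex.exp ((ℓ + k) * (b - a)) with hE₁
  set E₂ := Complex.exp ((ℓ - k) * (b - a)) with hE₂
  -- The moduli are `exp (± k (b - a))`, and these differ.
  have hne : E₁ - E₂ ≠ 0 := by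
    intro h
    have h' := congrArg norm (sub_eq_zero.1 h)
    rw [hE₁, hE₂, Complex.norm_exp, Complex.norm_exp, Real.exp_eq_exp] at h'
    simp [ℓ] at h'
    have : k * (b - a) = 0 := by linarith
    rcases mul_eq_zero.1 this with h | h
    · exact hk h
    · linarith
  -- `ψ a = 0` forces a common initial value `c`; `ψ b = 0` then reads `E₁ (c + β₁) = E₂ (c + β₂)`.
  obtain ⟨p, hp, hpa, hpb, hpd⟩ := H₁ (-(E₁ * β₁ - E₂ * β₂) / (E₁ - E₂))
  obtain ⟨m, hm, hma, hmb, hmd⟩ := H₂ (-(E₁ * β₁ - E₂ * β₂) / (E₁ - E₂))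
  have hpac := hp.absolutelyContinuous hab.le
  have hmac := hm.absolutelyContinuous hab.le
  have hder : ∀ σ : ℂ, ∀ᵐ y ∂(intervalMeasure a b),
      HasDerivAt (fun y => (1 / 2 : ℂ) * (p y + σ * m y))
        ((1 / 2 : ℂ) * (deriv p y + σ * deriv m y)) y := fun σ => by
    filter_upwards [hpd, hmd] with y h1 h2
    exact (h1.1.hasDerivAt.add (h2.1.hasDerivAt.const_mul σ)).const_mul _
  have hcomb : ∀ σ : ℂ, IsH1 a b (fun y => (1 / 2 : ℂ) * (p y + σ * m y)) := fun σ => by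
    refine (isH1_iff hab.le).2 ⟨(hpac.add (hmac.const_smul σ)).const_smul (1 / 2 : ℂ), ?_⟩
    refine ((hp.1.add (hm.1.const_mul σ)).const_mul (1 / 2 : ℂ)).ae_eq ?_
    filter_upwards [hder σ] with y h
    exact h.deriv.symm
  refine ⟨fun y => (1 / 2 : ℂ) * (p y + (-1) * m y), ⟨hcomb _, ?_, ?_⟩,
    fun y => (1 / 2 : ℂ) * (p y + 1 * m y), hcomb _, ?_, ?_⟩
  · simp [hpa, hma]
  · simp only
    rw [hpb, hmb]
    field_simp
    ring
  · filter_upwards [hpd, hmd, hder (-1)] with y h1 h2 h3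
    rw [shiftedDeriv, h3.deriv, h1.2, h2.2]
    simp only [ℓ]
    field_simp
    ring
  · filter_upwards [hpd, hmd, hder 1] with y h1 h2 h3
    rw [shiftedDeriv, h3.deriv, h1.2, h2.2]
    simp only [ℓ]
    field_simp
    ring

theorem isDirichletPotential_dirichletPotential (hab : a < b) {k : ℝ} (hk : k ≠ 0) (t : ℝ)
    {v : ℝ → ℂ} (hv : MemLp v 2 (intervalMeasure a b)) :
    IsDirichletPotential a b k t v (dirichletPotential a b k t v) :=
  Classical.epsilon_spec (exists_isDirichletPotential hab hk t hv)

/-- The weak form of the Dirichlet problem. -/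
theorem IsDirichletPotential.integral_conj_mul {k t : ℝ} {v ψ φ : ℝ → ℂ} (hab : a ≤ b)
    (h : IsDirichletPotential a b k t v ψ) (hφ : IsH10 a b φ) :
    ∫ y, star (φ y) * v y ∂(intervalMeasure a b) =
      -((∫ y, star (φ y) * ψ y ∂(intervalMeasure a b)) +
        ∫ y, star (shiftedDeriv k t φ y) * shiftedDeriv k t ψ y ∂(intervalMeasure a b)) := by
  obtain ⟨hψ, q, hq, hqe, hve⟩ := h
  have e1 : ∫ y, star (φ y) * v y ∂(intervalMeasure a b) =
      ∫ y, (-(star (φ y) * ψ y) + star (φ y) * shiftedDeriv k t q y) ∂(intervalMeasure a b) := by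
    refine integral_congr_ae ?_
    filter_upwards [hve] with y hy
    rw [← hy]
    ring
  have e2 : ∫ y, star (shiftedDeriv k t φ y) * q y ∂(intervalMeasure a b) =
      ∫ y, star (shiftedDeriv k t φ y) * shiftedDeriv k t ψ y ∂(intervalMeasure a b) := by
    refine integral_congr_ae ?_
    filter_upwards [hqe] with y hy
    rw [← hy]
  have hφ2 := hφ.1.memLp hab
  rw [e1, integral_add (f := fun y => -(star (φ y) * ψ y))
    (integrable_conj_mul hφ2 (hψ.1.memLp hab)).neg (integrable_conj_mul hφ2 (memLp_shiftedDeriv hab hq k t)), integral_neg,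
    integral_conj_mul_shiftedDeriv hab hφ hq, e2]
  ring

/-- Duality of the two energy norms. -/
theorem norm_integral_conj_mul_le (hab : a < b) {k : ℝ} (hk : k ≠ 0) (t : ℝ) {v φ : ℝ → ℂ}
    (hv : MemLp v 2 (intervalMeasure a b)) (hφ : IsH10 a b φ) :
    ‖∫ y, star (φ y) * v y ∂(intervalMeasure a b)‖ ≤
      hTildeNorm a b k t φ * hTildeNegNorm a b k t v := by
  have h := isDirichletPotential_dirichletPotential hab hk t hv
  rw [h.integral_conj_mul hab.le hφ, norm_neg]
  exact norm_energy_inner_le hab.le hφ.1 h.1.1 k t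

/-- The weak form tested with the solution itself. -/
theorem sq_hTildeNegNorm_le (hab : a < b) {k : ℝ} (hk : k ≠ 0) (t : ℝ) {v : ℝ → ℂ}
    (hv : MemLp v 2 (intervalMeasure a b)) :
    hTildeNegNorm a b k t v ^ 2 ≤
      ‖∫ y, star (dirichletPotential a b k t v y) * v y ∂(intervalMeasure a b)‖ := by
  have h := isDirichletPotential_dirichletPotential hab hk t hv
  have e : ∀ f : ℝ → ℂ, ∫ y, star (f y) * f y ∂(intervalMeasure a b) =
      ((∫ y, ‖f y‖ ^ 2 ∂(intervalMeasure a b) : ℝ) : ℂ) := fun f => by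
    rw [← integral_complex_ofReal]
    refine integral_congr_ae (Filter.Eventually.of_forall fun y => ?_)
    simp only [Complex.star_def, Complex.conj_mul']
    push_cast
    rfl
  rw [h.integral_conj_mul hab.le h.1, norm_neg, e, e, ← Complex.ofReal_add,
    ← sq_hTildeNorm hab.le, Complex.norm_real]
  exact le_abs_self _

end Dirichlet

/-! ### The Fourier basis -/

section Fourier

variable {a b : ℝ}

theorem norm_sq_eq_integral (u : L2 a b) : ‖u‖ ^ 2 = ∫ y, ‖u y‖ ^ 2 ∂(intervalMeasure a b) := by
  have h := norm_toLp_sq (Lp.memLp u)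
  rwa [Lp.toLp_coeFn] at h

/-- The coefficients `fourierCoeffOn` average over the interval, while `mode` carries `(b -
a)^{-1/2}`; the square root accounts for the difference. -/
theorem inner_mode_eq (hab : a < b) (m : ℤ) (u : L2 a b) :
    (inner ℂ (mode a b m) u : ℂ) = (Real.sqrt (b - a) : ℂ) * fourierCoeffOn hab u m := by
  have hpos : 0 < b - a := sub_pos.2 hab
  have hs : (Real.sqrt (b - a) : ℂ) ≠ 0 := by
    exact_mod_cast (Real.sqrt_pos.2 hpos).ne'
  have hsq : (Real.sqrt (b - a) : ℂ) * (Real.sqrt (b - a) : ℂ) = ((b - a : ℝ) : ℂ) := by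
    rw [← Complex.ofReal_mul, Real.mul_self_sqrt hpos.le]
  have hL : ((b - a : ℝ) : ℂ) ≠ 0 := by exact_mod_cast hpos.ne'
  have hu : (inner ℂ (mode a b m) u : ℂ) = ∫ y, star (modeFun a b m y) * u y
      ∂(intervalMeasure a b) := by
    have h := inner_toLp (memLp_modeFun a b m) (Lp.memLp u)
    rwa [Lp.toLp_coeFn] at h
  rw [hu, fourierCoeffOn_eq_integral, intervalIntegral.integral_of_le hab.le, Complex.real_smul,
    ← mul_assoc, ← integral_const_mul]
  refine integral_congr_ae (Filter.Eventually.of_forall fun y => ?_)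
  simp only [fourier_coe_apply, modeFun, freq, smul_eq_mul, Complex.star_def, map_div₀,
    Complex.conj_ofReal, ← Complex.exp_conj, map_mul, Complex.conj_I]
  rw [show (-Complex.I * ((2 * Real.pi * m / (b - a) * y : ℝ) : ℂ)) =
    2 * Real.pi * Complex.I * ((-m : ℤ) : ℂ) * y / ((b - a : ℝ) : ℂ) by push_cast; ring]
  rw [← mul_assoc]
  congr 1
  rw [div_eq_iff hs]
  push_cast
  push_cast at hsq hL
  field_simp
  linear_combination -hsq

/-- **Parseval's identity**. -/
theorem hasSum_sq_inner_mode (hab : a < b) (u : L2 a b) :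
    HasSum (fun m : ℤ => ‖(inner ℂ (mode a b m) u : ℂ)‖ ^ 2) (‖u‖ ^ 2) := by
  have hpos : 0 < b - a := sub_pos.2 hab
  have h := (hasSum_sq_fourierCoeffOn hab (Lp.memLp u)).mul_left (b - a)
  rw [intervalIntegral.integral_of_le hab.le, ← norm_sq_eq_integral, smul_eq_mul,
    mul_inv_cancel_left₀ hpos.ne'] at h
  refine h.congr_fun ?_
  intro m
  rw [inner_mode_eq hab, norm_mul, Complex.norm_real, mul_pow, Real.norm_eq_abs, sq_abs,
    Real.sq_sqrt hpos.le]

theorem norm_mode (hab : a < b) (m : ℤ) : ‖mode a b m‖ = 1 := by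
  have hpos : 0 < b - a := sub_pos.2 hab
  have h : ‖mode a b m‖ ^ 2 = 1 := by
    rw [mode, norm_toLp_sq]
    have : ∀ y, ‖modeFun a b m y‖ ^ 2 = (b - a)⁻¹ := fun y => by
      rw [modeFun, norm_div, mul_comm Complex.I, Complex.norm_exp_ofReal_mul_I, Complex.norm_real,
        Real.norm_of_nonneg (Real.sqrt_nonneg _), div_pow, Real.sq_sqrt hpos.le, one_pow, one_div]
    simp [this, hpos.le, hpos.ne']
  nlinarith [norm_nonneg (mode a b m)]

/-- In Parseval's identity for `mode a b m` the term of index `m` already exhausts the total `1`, so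
every other term vanishes. -/
theorem orthonormal_mode (hab : a < b) : Orthonormal ℂ (mode a b) := by
  refine ⟨norm_mode hab, fun n m hnm => ?_⟩
  have h := sum_le_hasSum {n, m} (fun i _ => by positivity) (hasSum_sq_inner_mode hab (mode a b m))
  rw [Finset.sum_pair hnm, inner_self_eq_norm_sq_to_K, norm_mode hab] at h
  have h0 : ‖(inner ℂ (mode a b n) (mode a b m) : ℂ)‖ ^ 2 ≤ 0 := by simpa using h
  exact norm_eq_zero.1 (pow_eq_zero_iff two_ne_zero |>.1 (le_antisymm h0 (by positivity)))

theorem eq_of_inner_mode_eq (hab : a < b) {u v : L2 a b}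
    (h : ∀ m, (inner ℂ (mode a b m) u : ℂ) = inner ℂ (mode a b m) v) : u = v := by
  have h1 := hasSum_sq_inner_mode hab (u - v)
  simp only [inner_sub_right, h, sub_self, norm_zero, ne_eq, OfNat.ofNat_ne_zero,
    not_false_eq_true, zero_pow] at h1
  have h2 := h1.unique hasSum_zero
  exact sub_eq_zero.1 (norm_eq_zero.1 (pow_eq_zero_iff two_ne_zero |>.1 h2))

/-- The functions `mode a b m` as a Hilbert basis. -/
noncomputable def modeBasis (hab : a < b) : HilbertBasis ℤ ℂ (L2 a b) :=
  HilbertBasis.mkOfOrthogonalEqBot (orthonormal_mode hab) (by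
    rw [Submodule.eq_bot_iff]
    intro u hu
    refine eq_of_inner_mode_eq hab fun m => ?_
    rw [inner_zero_right]
    exact (Submodule.mem_orthogonal _ _).1 hu _ (Submodule.subset_span ⟨m, rfl⟩))

theorem modeBasis_apply (hab : a < b) (m : ℤ) : modeBasis hab m = mode a b m := by
  rw [modeBasis, HilbertBasis.coe_mkOfOrthogonalEqBot]

theorem hasSum_inner_mode (hab : a < b) (u v : L2 a b) :
    HasSum (fun m => (inner ℂ u (mode a b m) : ℂ) * inner ℂ (mode a b m) v) (inner ℂ u v) := by
  simpa only [modeBasis_apply] using (modeBasis hab).hasSum_inner_mul_inner u v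

/-- Multiplication of the Fourier coefficients by a bounded sequence. -/
theorem exists_hasSum_multiplier (hab : a < b) {σ : ℤ → ℂ} {M : ℝ} (hσ : ∀ m, ‖σ m‖ ≤ M)
    (u : L2 a b) :
    ∃ v : L2 a b, HasSum (fun m => (σ m * inner ℂ (mode a b m) u) • mode a b m) v ∧
      ∀ m, (inner ℂ (mode a b m) v : ℂ) = σ m * inner ℂ (mode a b m) u := by
  have hmem : Memℓp (fun m => σ m * (inner ℂ (mode a b m) u : ℂ)) 2 := by
    refine memℓp_gen ?_
    refine Summable.of_nonneg_of_le (fun m => by positivity) (fun m => ?_)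
      ((hasSum_sq_inner_mode hab u).summable.mul_left (M ^ 2))
    simp only [ENNReal.toReal_ofNat, Real.rpow_ofNat, norm_mul, mul_pow]
    gcongr
    exact hσ m
  refine ⟨(modeBasis hab).repr.symm ⟨_, hmem⟩, ?_, fun m => ?_⟩
  · simpa only [modeBasis_apply] using (modeBasis hab).hasSum_repr_symm ⟨_, hmem⟩
  · rw [← modeBasis_apply hab, ← HilbertBasis.repr_apply_apply,
      LinearIsometryEquiv.apply_symm_apply, modeBasis_apply]

end Fourier

/-! ### The Fourier weight -/

section Weight

variable {a b : ℝ}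

/-- The shifted frequency `n / k - t`. -/
noncomputable def shiftedFreq (a b k t : ℝ) (m : ℤ) : ℝ := freq a b m / k - t

/-- The symbol of the weight. -/
noncomputable def weight (a b k t : ℝ) (m : ℤ) : ℝ :=
  Real.exp (Real.arctan (shiftedFreq a b k t m))

theorem weight_pos (k t : ℝ) (m : ℤ) : 0 < weight a b k t m := Real.exp_pos _

theorem weight_le (k t : ℝ) (m : ℤ) : weight a b k t m ≤ Real.exp (Real.pi / 2) :=
  Real.exp_le_exp.2 (Real.arctan_lt_pi_div_two _).le

theorem le_weight (k t : ℝ) (m : ℤ) : Real.exp (-(Real.pi / 2)) ≤ weight a b k t m :=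
  Real.exp_le_exp.2 (Real.neg_pi_div_two_lt_arctan _).le

theorem hasDerivAt_weight (k t : ℝ) (m : ℤ) :
    HasDerivAt (fun s => weight a b k s m)
      (-(weight a b k t m / (1 + shiftedFreq a b k t m ^ 2))) t := by
  have h : HasDerivAt (fun s => shiftedFreq a b k s m) (-1) t := by
    simpa [shiftedFreq] using (hasDerivAt_id t).const_sub (freq a b m / k)
  refine h.arctan.exp.congr_deriv ?_
  simp only [weight]
  ring

theorem weight_div_le (k t : ℝ) (m : ℤ) :
    weight a b k t m / (1 + shiftedFreq a b k t m ^ 2) ≤ Real.exp (Real.pi / 2) :=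
  (div_le_self (weight_pos k t m).le (by nlinarith [sq_nonneg (shiftedFreq a b k t m)])).trans
    (weight_le k t m)

/-- The mean value inequality. Uniformity in `m` makes `t ↦ A(t)` Lipschitz in operator norm. -/
theorem abs_weight_sub_le (k s t : ℝ) (m : ℤ) :
    |weight a b k s m - weight a b k t m| ≤ Real.exp (Real.pi / 2) * |s - t| := by
  refine Convex.norm_image_sub_le_of_norm_hasDerivWithin_le
    (fun x _ => (hasDerivAt_weight (a := a) (b := b) k x m).hasDerivWithinAt) (fun x _ => ?_)
    convex_univ (mem_univ t) (mem_univ s)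
  rw [norm_neg, Real.norm_of_nonneg (by have := weight_pos (a := a) (b := b) k x m; positivity)]
  exact weight_div_le k x m

theorem inner_mode_weightOp (hab : a < b) (k t : ℝ) (u : L2 a b) (m : ℤ) :
    (inner ℂ (mode a b m) (weightOp a b k t u) : ℂ) =
      (weight a b k t m : ℂ) * inner ℂ (mode a b m) u := by
  obtain ⟨v, h1, h2⟩ := exists_hasSum_multiplier hab (σ := fun m => (weight a b k t m : ℂ))
    (M := Real.exp (Real.pi / 2)) (fun m => by
      rw [Complex.norm_real, Real.norm_of_nonneg (weight_pos k t m).le]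
      exact weight_le k t m) u
  have : weightOp a b k t u = v := h1.tsum_eq
  rw [this, h2]

theorem weightOp_sub (hab : a < b) (k t : ℝ) (u v : L2 a b) :
    weightOp a b k t (u - v) = weightOp a b k t u - weightOp a b k t v :=
  eq_of_inner_mode_eq hab fun m => by
    simp only [inner_mode_weightOp hab, inner_sub_right, mul_sub]

theorem inner_weightOp_left (hab : a < b) (k t : ℝ) (u v : L2 a b) :
    (inner ℂ (weightOp a b k t u) v : ℂ) = inner ℂ u (weightOp a b k t v) := by
  refine (hasSum_inner_mode hab (weightOp a b k t u) v).unique ?_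
  refine (hasSum_inner_mode hab u (weightOp a b k t v)).congr_fun fun m => ?_
  rw [← inner_conj_symm, inner_mode_weightOp hab, inner_mode_weightOp hab, map_mul,
    Complex.conj_ofReal, inner_conj_symm]
  ring

theorem norm_weightOp_sub_le (hab : a < b) (k s t : ℝ) (u : L2 a b) :
    ‖weightOp a b k s u - weightOp a b k t u‖ ≤ Real.exp (Real.pi / 2) * |s - t| * ‖u‖ := by
  refine (pow_le_pow_iff_left₀ (norm_nonneg _) (by positivity) two_ne_zero).1 ?_
  rw [mul_pow]
  refine hasSum_le (fun m => ?_) (hasSum_sq_inner_mode hab _)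
    ((hasSum_sq_inner_mode hab u).mul_left _)
  rw [inner_sub_right, inner_mode_weightOp hab, inner_mode_weightOp hab, ← sub_mul, norm_mul,
    mul_pow, ← Complex.ofReal_sub, Complex.norm_real, Real.norm_eq_abs]
  gcongr
  exact abs_weight_sub_le k s t m

theorem norm_weightOp_le (hab : a < b) (k t : ℝ) (u : L2 a b) :
    ‖weightOp a b k t u‖ ≤ Real.exp (Real.pi / 2) * ‖u‖ := by
  refine (pow_le_pow_iff_left₀ (norm_nonneg _) (by positivity) two_ne_zero).1 ?_
  rw [mul_pow]
  refine hasSum_le (fun m => ?_) (hasSum_sq_inner_mode hab _)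
    ((hasSum_sq_inner_mode hab u).mul_left _)
  rw [inner_mode_weightOp hab, norm_mul, mul_pow, Complex.norm_real,
    Real.norm_of_nonneg (weight_pos k t m).le]
  have := (weight_pos (a := a) (b := b) k t m).le
  gcongr
  exact weight_le k t m

theorem hasSum_weightForm (hab : a < b) (k t : ℝ) (u : L2 a b) :
    HasSum (fun m => weight a b k t m * ‖(inner ℂ (mode a b m) u : ℂ)‖ ^ 2)
      (weightForm a b k t u) := by
  refine (Complex.hasSum_re (hasSum_inner_mode hab u (weightOp a b k t u))).congr_fun fun m => ?_
  rw [inner_mode_weightOp hab, ← inner_conj_symm u, mul_left_comm, Complex.conj_mul',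
    Complex.re_ofReal_mul]
  norm_cast

theorem weightForm_le (hab : a < b) (k t : ℝ) (u : L2 a b) :
    weightForm a b k t u ≤ Real.exp (Real.pi / 2) * ‖u‖ ^ 2 :=
  hasSum_le (fun m => mul_le_mul_of_nonneg_right (weight_le k t m) (by positivity))
    (hasSum_weightForm hab k t u) ((hasSum_sq_inner_mode hab u).mul_left _)

theorem le_weightForm (hab : a < b) (k t : ℝ) (u : L2 a b) :
    Real.exp (-(Real.pi / 2)) * ‖u‖ ^ 2 ≤ weightForm a b k t u :=
  hasSum_le (fun m => mul_le_mul_of_nonneg_right (le_weight k t m) (by positivity))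
    ((hasSum_sq_inner_mode hab u).mul_left _) (hasSum_weightForm hab k t u)

/-- Termwise differentiation, dominated by `exp (π/2)` times the Parseval series of `u`. -/
theorem hasDerivAt_weightForm (hab : a < b) (k t : ℝ) (u : L2 a b) :
    HasDerivAt (fun s => weightForm a b k s u)
      (∑' m, -(weight a b k t m / (1 + shiftedFreq a b k t m ^ 2)) *
        ‖(inner ℂ (mode a b m) u : ℂ)‖ ^ 2) t := by
  have e : (fun s => weightForm a b k s u) = fun s =>
      ∑' m, weight a b k s m * ‖(inner ℂ (mode a b m) u : ℂ)‖ ^ 2 :=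
    funext fun s => (hasSum_weightForm hab k s u).tsum_eq.symm
  rw [e]
  refine hasDerivAt_tsum (y₀ := t)
    ((hasSum_sq_inner_mode hab u).summable.mul_left (Real.exp (Real.pi / 2)))
    (fun m s => (hasDerivAt_weight k s m).mul_const _) (fun m s => ?_)
    (hasSum_weightForm hab k t u).summable t
  have := weight_pos (a := a) (b := b) k s m
  rw [norm_mul, norm_neg, Real.norm_of_nonneg (by positivity), norm_pow, norm_norm]
  gcongr
  exact weight_div_le k s m

/-! ### The weight constant -/

theorem deriv_modeFun (m : ℤ) (y : ℝ) :
    deriv (modeFun a b m) y = Complex.I * (freq a b m : ℂ) * modeFun a b m y := by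
  have h1 : HasDerivAt (fun y : ℝ => Complex.I * ((freq a b m * y : ℝ) : ℂ))
      (Complex.I * ((freq a b m * 1 : ℝ) : ℂ)) y :=
    (((hasDerivAt_id y).const_mul (freq a b m)).ofReal_comp).const_mul Complex.I
  have h2 := h1.cexp.div_const ((Real.sqrt (b - a) : ℝ) : ℂ)
  refine Eq.trans h2.deriv ?_
  rw [modeFun, mul_one]
  ring

theorem isH1_modeFun (hab : a ≤ b) (m : ℤ) : IsH1 a b (modeFun a b m) := by
  refine isH1_of_contDiff hab ?_
  have : ContDiff ℝ 1 (fun y : ℝ => (y : ℂ)) := Complex.ofRealCLM.contDiff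
  have h2 : ContDiff ℝ 1 (fun y : ℝ => (((freq a b m * y : ℝ)) : ℂ)) := by
    simp only [Complex.ofReal_mul]
    fun_prop
  unfold modeFun
  fun_prop

/-- Each mode is an eigenfunction of `D` with eigenvalue `i (n/k - t)`, and the zero boundary values
of `φ` allow `D` to be moved onto the mode. -/
theorem norm_inner_mode_shiftedDeriv (hab : a ≤ b) {k : ℝ} (t : ℝ) {φ : ℝ → ℂ}
    (hφ : IsH10 a b φ) (m : ℤ) :
    ‖(inner ℂ (mode a b m) ((memLp_shiftedDeriv hab hφ.1 k t).toLp _) : ℂ)‖ =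
      |shiftedFreq a b k t m| * ‖(inner ℂ (mode a b m) ((hφ.1.memLp hab).toLp _) : ℂ)‖ := by
  rw [norm_inner_symm, norm_inner_symm (mode a b m), mode, inner_toLp, inner_toLp, ← norm_neg,
    ← integral_conj_mul_shiftedDeriv hab hφ (isH1_modeFun hab m)]
  have : ∀ y, star (φ y) * shiftedDeriv k t (modeFun a b m) y =
      Complex.I * (shiftedFreq a b k t m : ℂ) * (star (φ y) * modeFun a b m y) := fun y => by
    rw [shiftedDeriv, deriv_modeFun, shiftedFreq]
    push_cast
    ring
  simp only [this]
  rw [integral_const_mul, norm_mul, norm_mul, Complex.norm_I, Complex.norm_real, one_mul,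
    Real.norm_eq_abs]

/-- The energy norm on `H¹₀` in terms of the Fourier coefficients. -/
theorem hasSum_sq_hTildeNorm (hab : a < b) (k t : ℝ) {φ : ℝ → ℂ} (hφ : IsH10 a b φ) :
    HasSum (fun m => (1 + shiftedFreq a b k t m ^ 2) *
      ‖(inner ℂ (mode a b m) ((hφ.1.memLp hab.le).toLp _) : ℂ)‖ ^ 2)
      (hTildeNorm a b k t φ ^ 2) := by
  rw [sq_hTildeNorm hab.le, ← norm_toLp_sq (hφ.1.memLp hab.le),
    ← norm_toLp_sq (memLp_shiftedDeriv hab.le hφ.1 k t)]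
  refine ((hasSum_sq_inner_mode hab _).add (hasSum_sq_inner_mode hab _)).congr_fun fun m => ?_
  rw [norm_inner_mode_shiftedDeriv hab.le t hφ, mul_pow, sq_abs]
  ring

theorem summable_sq_div (hab : a < b) (k t : ℝ) (v : L2 a b) :
    Summable fun m => ‖(inner ℂ (mode a b m) v : ℂ)‖ ^ 2 / (1 + shiftedFreq a b k t m ^ 2) :=
  Summable.of_nonneg_of_le (fun m => by positivity)
    (fun m => div_le_self (by positivity) (by nlinarith [sq_nonneg (shiftedFreq a b k t m)]))
    (hasSum_sq_inner_mode hab v).summable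

/-- The dual energy norm is bounded by its periodic counterpart. -/
theorem sq_hTildeNegNorm_le_tsum (hab : a < b) {k : ℝ} (hk : k ≠ 0) (t : ℝ) (v : L2 a b) :
    hTildeNegNorm a b k t v ^ 2 ≤
      ∑' m, ‖(inner ℂ (mode a b m) v : ℂ)‖ ^ 2 / (1 + shiftedFreq a b k t m ^ 2) := by
  have hψ := (isDirichletPotential_dirichletPotential hab hk t (Lp.memLp v)).1
  have h1 := sq_hTildeNegNorm_le hab hk t (Lp.memLp v)
  have h2 := hasSum_sq_hTildeNorm hab k t hψ
  have h3 := inner_toLp (hψ.1.memLp hab.le) (Lp.memLp v)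
  rw [Lp.toLp_coeFn] at h3
  rw [← h3] at h1
  -- Young's inequality `x y ≤ (q x² + y²/q) / 2` in each mode, with `q = 1 + (n/k - t)²`. The sum
  -- of `q x²` is the left-hand side of the claim, so half of it is absorbed.
  have h4 := (hasSum_inner_mode hab ((hψ.1.memLp hab.le).toLp _) v).norm_le_of_bounded
    ((h2.add (summable_sq_div hab k t v).hasSum).mul_left (1 / 2)) (fun m => by
      rw [norm_mul, norm_inner_symm]
      set x := ‖(inner ℂ (mode a b m) ((hψ.1.memLp hab.le).toLp _) : ℂ)‖
      set y := ‖(inner ℂ (mode a b m) v : ℂ)‖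
      have hq : 0 < 1 + shiftedFreq a b k t m ^ 2 := by positivity
      have := sq_nonneg ((1 + shiftedFreq a b k t m ^ 2) * x - y)
      have e : 1 / 2 * ((1 + shiftedFreq a b k t m ^ 2) * x ^ 2 +
          y ^ 2 / (1 + shiftedFreq a b k t m ^ 2)) - x * y =
          ((1 + shiftedFreq a b k t m ^ 2) * x - y) ^ 2 /
            (2 * (1 + shiftedFreq a b k t m ^ 2)) := by
        field_simp
        ring
      have : 0 ≤ ((1 + shiftedFreq a b k t m ^ 2) * x - y) ^ 2 /
            (2 * (1 + shiftedFreq a b k t m ^ 2)) := by positivity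
      linarith)
  have h5 : hTildeNorm a b k t (dirichletPotential a b k t v) = hTildeNegNorm a b k t v := rfl
  rw [h5] at h4
  linarith

theorem IsWaveNumber.ne_zero {k : ℝ} (hk : IsWaveNumber k) : k ≠ 0 := by
  obtain ⟨m, hm, rfl⟩ := hk
  have : (m : ℝ) ≠ 0 := by exact_mod_cast hm
  have := Real.pi_ne_zero
  positivity

/-- `exp (π / 2)` is an admissible weight constant for every interval and every wave number. -/
theorem isWeightConstant_exp_pi_div_two (hab : a < b) {k : ℝ} (hk : k ≠ 0) :
    IsWeightConstant a b k (Real.exp (Real.pi / 2)) := by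
  intro t u
  rw [(hasDerivAt_weightForm hab k t u).deriv]
  set E := Real.exp (Real.pi / 2) with hE
  have hE0 : 0 < E := Real.exp_pos _
  set T := ∑' m, (weight a b k t m / (1 + shiftedFreq a b k t m ^ 2)) *
    ‖(inner ℂ (mode a b m) u : ℂ)‖ ^ 2 with hT
  have hTs : Summable fun m => (weight a b k t m / (1 + shiftedFreq a b k t m ^ 2)) *
      ‖(inner ℂ (mode a b m) u : ℂ)‖ ^ 2 := by
    refine Summable.of_nonneg_of_le (fun m => ?_) (fun m => ?_)
      ((hasSum_sq_inner_mode hab u).summable.mul_left E)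
    · have := weight_pos (a := a) (b := b) k t m
      positivity
    · exact mul_le_mul_of_nonneg_right (weight_div_le k t m) (by positivity)
  have hT0 : 0 ≤ T := tsum_nonneg fun m => by
    have := weight_pos (a := a) (b := b) k t m
    positivity
  have e : -E * ∑' m, -(weight a b k t m / (1 + shiftedFreq a b k t m ^ 2)) *
      ‖(inner ℂ (mode a b m) u : ℂ)‖ ^ 2 = E * T := by
    simp only [neg_mul, tsum_neg, mul_neg, neg_neg, hT]
  rw [e]
  -- Both squared norms are bounded by the same `E * T`: for `u` because `1 ≤ E * weight`, for `A u`
  -- because `weight ≤ E`. The product of the norms then follows from `2 x y ≤ x² + y²`.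
  have h1 : hTildeNegNorm a b k t u ^ 2 ≤ E * T := by
    refine (sq_hTildeNegNorm_le_tsum hab hk t u).trans ?_
    rw [hT, ← tsum_mul_left]
    refine (summable_sq_div hab k t u).tsum_le_tsum (fun m => ?_) (hTs.mul_left E)
    have hw : 1 ≤ E * weight a b k t m := by
      calc (1 : ℝ) = E * Real.exp (-(Real.pi / 2)) := by rw [hE, ← Real.exp_add]; simp
        _ ≤ _ := by gcongr; exact le_weight k t m
    calc _ ≤ (E * weight a b k t m) * (‖(inner ℂ (mode a b m) u : ℂ)‖ ^ 2 /
          (1 + shiftedFreq a b k t m ^ 2)) := le_mul_of_one_le_left (by positivity) hw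
      _ = _ := by ring
  have h2 : hTildeNegNorm a b k t (weightOp a b k t u) ^ 2 ≤ E * T := by
    refine (sq_hTildeNegNorm_le_tsum hab hk t _).trans ?_
    rw [hT, ← tsum_mul_left]
    refine (summable_sq_div hab k t _).tsum_le_tsum (fun m => ?_) (hTs.mul_left E)
    have hw := weight_pos (a := a) (b := b) k t m
    rw [inner_mode_weightOp hab, norm_mul, Complex.norm_real, Real.norm_of_nonneg hw.le]
    calc _ = weight a b k t m * (weight a b k t m / (1 + shiftedFreq a b k t m ^ 2) *
          ‖(inner ℂ (mode a b m) u : ℂ)‖ ^ 2) := by ring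
      _ ≤ _ := by gcongr; exact weight_le k t m
  nlinarith [sq_nonneg (hTildeNegNorm a b k t u - hTildeNegNorm a b k t (weightOp a b k t u))]

end Weight

/-! ### The elliptic estimate -/

section Elliptic

variable {a b : ℝ}

/-- The energy identity for the stream function, tested with `(r / g) Φ`. -/
theorem IsStreamFunction.integral_conj_mul {g r : ℝ → ℝ} {k t : ℝ} {w Φ : ℝ → ℂ} (hab : a ≤ b)
    (hk : k ≠ 0) (hw : MemLp w 2 (intervalMeasure a b))
    (hΦ : IsStreamFunction a b g r k t w Φ)
    (hr : IsH1 a b fun y => (r y : ℂ)) (hρ : IsH1 a b fun y => ((r y / g y : ℝ) : ℂ))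
    (hr0 : ∀ᵐ y ∂(intervalMeasure a b), r y ≠ 0) (hg0 : ∀ᵐ y ∂(intervalMeasure a b), g y ≠ 0)
    (hr' : ∀ᵐ y ∂(intervalMeasure a b), deriv (fun y => (r y : ℂ)) y = (((g y)⁻¹ : ℝ) : ℂ)) :
    Integrable (fun y => r y * g y * ‖shiftedDeriv k t Φ y‖ ^ 2 + (r y * g y)⁻¹ * ‖Φ y‖ ^ 2)
      (intervalMeasure a b) ∧
    ∫ y, star (((r y / g y : ℝ) : ℂ) * Φ y) * w y ∂(intervalMeasure a b) =
      -((∫ y, (r y * g y * ‖shiftedDeriv k t Φ y‖ ^ 2 + (r y * g y)⁻¹ * ‖Φ y‖ ^ 2)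
        ∂(intervalMeasure a b) : ℝ) : ℂ) := by
  obtain ⟨hΦ0, p, hp, hpe, hwe⟩ := hΦ
  have hrΦ := hΦ0.mul_left hab hr
  have hρΦ := hΦ0.mul_left hab hρ
  have i0 := integrable_conj_mul (hρΦ.1.memLp hab) hw
  have i1 := integrable_conj_mul (hrΦ.1.memLp hab) (memLp_shiftedDeriv hab hp k t)
  have i2 := integrable_conj_mul (memLp_shiftedDeriv hab hrΦ.1 k t) (hp.memLp hab)
  have hkc : (k : ℂ) ≠ 0 := by exact_mod_cast hk
  -- As `r' = 1/g`, the product rule gives `D (r Φ) = r D Φ + Φ/(k g)`; its last term, multiplied by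
  -- `p = g D Φ`, cancels the first order term of the equation.
  have key : ∀ᵐ y ∂(intervalMeasure a b),
      (star (((r y / g y : ℝ) : ℂ) * Φ y) * w y - star ((r y : ℂ) * Φ y) * shiftedDeriv k t p y) -
        star (shiftedDeriv k t (fun y => (r y : ℂ) * Φ y) y) * p y =
      ((-(r y * g y * ‖shiftedDeriv k t Φ y‖ ^ 2 + (r y * g y)⁻¹ * ‖Φ y‖ ^ 2) : ℝ) : ℂ) := by
    filter_upwards [hpe, hwe, hr0, hg0, hr', shiftedDeriv_mul hab hr hΦ0.1 k t]
      with y h1 h2 h3 h4 h5 h6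
    have h3' : (r y : ℂ) ≠ 0 := by exact_mod_cast h3
    have h4' : (g y : ℂ) ≠ 0 := by exact_mod_cast h4
    rw [← h2, h6, h5, h1]
    simp only [star_add, star_mul', star_div₀, Complex.star_def, Complex.conj_ofReal]
    push_cast
    rw [← Complex.conj_mul', ← Complex.conj_mul']
    field_simp
    ring
  refine ⟨?_, ?_⟩
  -- Integrability of the energy density is read off from `key`, whose left side is a combination of
  -- integrable products.
  · refine ((i0.sub i1).sub i2).neg.re.congr ?_
    filter_upwards [key] with y hy
    simp only [Pi.neg_apply, Pi.sub_apply]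
    rw [hy, ← Complex.ofReal_neg, neg_neg]
    exact Complex.ofReal_re _
  · have e := integral_sub (i0.sub i1) i2
    simp only [Pi.sub_apply] at e
    rw [← Complex.ofReal_neg, ← integral_neg, ← integral_complex_ofReal, ← integral_congr_ae key,
      e, integral_sub i0 i1, integral_conj_mul_shiftedDeriv hab hrΦ hp]
    ring

/-- The elliptic estimate for a coefficient `g` of constant sign. -/
theorem IsStreamFunction.hTildeNorm_le {g r : ℝ → ℝ} {k t ε c₀ R₀ R₁ : ℝ} {w Φ : ℝ → ℂ}
    (hab : a < b) (hk : 1 ≤ |k|) (hw : MemLp w 2 (intervalMeasure a b))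
    (hΦ : IsStreamFunction a b g r k t w Φ)
    (hr : IsH1 a b fun y => (r y : ℂ)) (hρ : IsH1 a b fun y => ((r y / g y : ℝ) : ℂ))
    (hr' : ∀ᵐ y ∂(intervalMeasure a b), deriv (fun y => (r y : ℂ)) y = (((g y)⁻¹ : ℝ) : ℂ))
    (hε : |ε| = 1) (hc₀ : 0 < c₀)
    (h₁ : ∀ᵐ y ∂(intervalMeasure a b), c₀ ≤ ε * (r y * g y))
    (h₂ : ∀ᵐ y ∂(intervalMeasure a b), c₀ ≤ ε * (r y * g y)⁻¹)
    (hR₀ : 0 ≤ R₀) (hR₁ : 0 ≤ R₁)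
    (h₃ : ∀ᵐ y ∂(intervalMeasure a b), ‖((r y / g y : ℝ) : ℂ)‖ ≤ R₀)
    (h₄ : ∀ᵐ y ∂(intervalMeasure a b), ‖deriv (fun y => ((r y / g y : ℝ) : ℂ)) y‖ ≤ R₁) :
    hTildeNorm a b k t Φ ≤ (R₀ + R₁) / c₀ * hTildeNegNorm a b k t w := by
  have hk0 : k ≠ 0 := by
    rintro rfl
    norm_num at hk
  have hrg : ∀ᵐ y ∂(intervalMeasure a b), r y * g y ≠ 0 := by
    filter_upwards [h₁] with y hy h0
    rw [h0] at hy
    linarith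
  obtain ⟨hint, hid⟩ := hΦ.integral_conj_mul hab.le hk0 hw hr hρ
    (hrg.mono fun y hy => left_ne_zero_of_mul hy) (hrg.mono fun y hy => right_ne_zero_of_mul hy) hr'
  have hΦ0 := hΦ.1
  have hdual := norm_integral_conj_mul_le hab hk0 t hw (hΦ0.mul_left hab.le hρ)
  have hmul := hTildeNorm_mul_le (k := k) hab.le hρ hΦ0.1 t hR₀ hR₁ h₃ h₄
  set G := ∫ y, (r y * g y * ‖shiftedDeriv k t Φ y‖ ^ 2 + (r y * g y)⁻¹ * ‖Φ y‖ ^ 2)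
    ∂(intervalMeasure a b) with hG
  rw [hid, norm_neg, Complex.norm_real, Real.norm_eq_abs] at hdual
  have hcoer : c₀ * hTildeNorm a b k t Φ ^ 2 ≤ |G| := by
    have iΦ := (hΦ0.1.memLp hab.le).integrable_norm_pow two_ne_zero
    have iD := (memLp_shiftedDeriv hab.le hΦ0.1 k t).integrable_norm_pow two_ne_zero
    calc c₀ * hTildeNorm a b k t Φ ^ 2
        = ∫ y, c₀ * (‖Φ y‖ ^ 2 + ‖shiftedDeriv k t Φ y‖ ^ 2) ∂(intervalMeasure a b) := by
          rw [integral_const_mul, integral_add iΦ iD, sq_hTildeNorm hab.le]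
      _ ≤ ∫ y, ε * (r y * g y * ‖shiftedDeriv k t Φ y‖ ^ 2 + (r y * g y)⁻¹ * ‖Φ y‖ ^ 2)
            ∂(intervalMeasure a b) := by
          refine integral_mono_ae ((iΦ.add iD).const_mul c₀) (hint.const_mul ε) ?_
          filter_upwards [h₁, h₂] with y e1 e2
          have := mul_le_mul_of_nonneg_right e1 (sq_nonneg ‖shiftedDeriv k t Φ y‖)
          have := mul_le_mul_of_nonneg_right e2 (sq_nonneg ‖Φ y‖)
          linarith
      _ = ε * G := by rw [integral_const_mul]
      _ ≤ |ε * G| := le_abs_self _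
      _ = |G| := by rw [abs_mul, hε, one_mul]
  have hk1 : |k|⁻¹ ≤ 1 := inv_le_one_of_one_le₀ hk
  have hN := hTildeNorm_nonneg a b k t Φ
  have hW := hTildeNegNorm_nonneg a b k t w
  -- Coercivity, duality and the multiplier bound for `r/g` in one line; `|k| ≥ 1` removes `k` from
  -- the constant. One factor of the norm of `Φ` is divided out afterwards.
  have hchain : c₀ * hTildeNorm a b k t Φ ^ 2 ≤
      (R₀ + R₁) * hTildeNorm a b k t Φ * hTildeNegNorm a b k t w := by
    refine hcoer.trans (hdual.trans (mul_le_mul_of_nonneg_right (hmul.trans ?_) hW))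
    gcongr
    exact mul_le_of_le_one_left hR₁ hk1
  rcases hN.eq_or_lt with h0 | hpos
  · rw [← h0]
    positivity
  · rw [div_mul_eq_mul_div, le_div_iff₀ hc₀]
    refine le_of_mul_le_mul_right ?_ hpos
    linarith

end Elliptic

/-! ### Geometry of the angular velocity -/

section AngularVelocity

variable {r₁ r₂ : ℝ} {U : ℝ → ℝ}

namespace IsAngularVelocity

theorem leftEnd_lt_rightEnd (hU : IsAngularVelocity r₁ r₂ U) :
    leftEnd r₁ r₂ U < rightEnd r₁ r₂ U := by
  have h1 : r₁ ∈ Icc r₁ r₂ := left_mem_Icc.2 hU.lt.le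
  have h2 : r₂ ∈ Icc r₁ r₂ := right_mem_Icc.2 hU.lt.le
  refine min_lt_max.2 ?_
  rcases hU.strictMono_or_strictAnti with h | h
  · exact (h h1 h2 hU.lt).ne
  · exact (h h1 h2 hU.lt).ne'

theorem continuousOn (hU : IsAngularVelocity r₁ r₂ U) : ContinuousOn U (Icc r₁ r₂) :=
  hU.differentiableOn.continuousOn

theorem hasDerivAt (hU : IsAngularVelocity r₁ r₂ U) {x : ℝ} (hx : x ∈ Ioo r₁ r₂) :
    HasDerivAt U (derivWithin U (Icc r₁ r₂) x) x :=
  (hU.differentiableOn x (Ioo_subset_Icc_self hx)).hasDerivWithinAt.hasDerivAt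
    (Icc_mem_nhds hx.1 hx.2)

/-- The derivative has a constant sign and is bounded away from zero and infinity. -/
theorem exists_bounds (hU : IsAngularVelocity r₁ r₂ U) :
    ∃ ε c M : ℝ, |ε| = 1 ∧ 0 < c ∧ 0 < M ∧ ∀ x ∈ Icc r₁ r₂,
      c ≤ ε * derivWithin U (Icc r₁ r₂) x ∧ ε * derivWithin U (Icc r₁ r₂) x ≤ M := by
  obtain ⟨K, hK⟩ := hU.lipschitz_deriv
  have hsign : ∃ ε : ℝ, |ε| = 1 ∧ ∀ x ∈ Icc r₁ r₂, 0 < ε * derivWithin U (Icc r₁ r₂) x := by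
    rcases hU.strictMono_or_strictAnti with h | h
    · refine ⟨1, by simp, fun x hx => ?_⟩
      rw [one_mul]
      exact lt_of_le_of_ne h.monotoneOn.derivWithin_nonneg (hU.deriv_ne_zero x hx).symm
    · refine ⟨-1, by simp, fun x hx => ?_⟩
      rw [neg_one_mul, neg_pos]
      exact lt_of_le_of_ne h.antitoneOn.derivWithin_nonpos (hU.deriv_ne_zero x hx)
  obtain ⟨ε, hε, hpos⟩ := hsign
  have hc : ContinuousOn (fun x => ε * derivWithin U (Icc r₁ r₂) x) (Icc r₁ r₂) :=
    hK.continuousOn.const_mul ε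
  have hne : (Icc r₁ r₂).Nonempty := nonempty_Icc.2 hU.lt.le
  obtain ⟨x, hx, hmin⟩ := isCompact_Icc.exists_isMinOn hne hc
  obtain ⟨z, hz, hmax⟩ := isCompact_Icc.exists_isMaxOn hne hc
  exact ⟨ε, _, _, hε, hpos x hx, hpos z hz, fun y hy => ⟨hmin hy, hmax hy⟩⟩

theorem surjOn (hU : IsAngularVelocity r₁ r₂ U) :
    SurjOn U (Icc r₁ r₂) (Icc (leftEnd r₁ r₂ U) (rightEnd r₁ r₂ U)) :=
  hU.continuousOn.surjOn_uIcc (left_mem_Icc.2 hU.lt.le) (right_mem_Icc.2 hU.lt.le)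

theorem radius_mem (hU : IsAngularVelocity r₁ r₂ U) {y : ℝ}
    (hy : y ∈ Icc (leftEnd r₁ r₂ U) (rightEnd r₁ r₂ U)) : radius r₁ r₂ U y ∈ Icc r₁ r₂ :=
  Function.invFunOn_mem (hU.surjOn hy)

theorem apply_radius (hU : IsAngularVelocity r₁ r₂ U) {y : ℝ}
    (hy : y ∈ Icc (leftEnd r₁ r₂ U) (rightEnd r₁ r₂ U)) : U (radius r₁ r₂ U y) = y :=
  Function.invFunOn_eq (hU.surjOn hy)

/-- `U` expands distances. -/
theorem mul_abs_sub_le (hU : IsAngularVelocity r₁ r₂ U) {ε c : ℝ} (hε : |ε| = 1)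
    (hc : ∀ x ∈ Icc r₁ r₂, c ≤ ε * derivWithin U (Icc r₁ r₂) x) {x z : ℝ} (hx : x ∈ Icc r₁ r₂)
    (hz : z ∈ Icc r₁ r₂) : c * |x - z| ≤ |U x - U z| := by
  wlog hzx : z ≤ x generalizing x z
  · rw [abs_sub_comm x, abs_sub_comm (U x)]
    exact this hz hx (le_of_not_ge hzx)
  have h := (convex_Icc r₁ r₂).mul_sub_le_image_sub_of_le_deriv (f := fun x => ε * U x) (C := c)
    (hU.continuousOn.const_mul ε) (fun y hy => by
      rw [interior_Icc] at hy
      exact ((hU.hasDerivAt hy).const_mul ε).differentiableAt.differentiableWithinAt)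
    (fun y hy => by
      rw [interior_Icc] at hy
      rw [((hU.hasDerivAt hy).const_mul ε).deriv]
      exact hc y (Ioo_subset_Icc_self hy)) z hz x hx hzx
  rw [abs_of_nonneg (sub_nonneg.2 hzx)]
  calc c * (x - z) ≤ ε * U x - ε * U z := h
    _ = ε * (U x - U z) := by ring
    _ ≤ |ε * (U x - U z)| := le_abs_self _
    _ = |U x - U z| := by rw [abs_mul, hε, one_mul]

theorem lipschitzOnWith_radius (hU : IsAngularVelocity r₁ r₂ U) :
    ∃ K : ℝ≥0, LipschitzOnWith K (radius r₁ r₂ U) (Icc (leftEnd r₁ r₂ U) (rightEnd r₁ r₂ U)) := by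
  obtain ⟨ε, c, M, hε, hc, -, hb⟩ := hU.exists_bounds
  refine ⟨(c⁻¹).toNNReal, LipschitzOnWith.of_dist_le_mul fun y hy z hz => ?_⟩
  have h := hU.mul_abs_sub_le hε (fun x hx => (hb x hx).1) (hU.radius_mem hy) (hU.radius_mem hz)
  rw [hU.apply_radius hy, hU.apply_radius hz] at h
  rw [Real.coe_toNNReal _ (inv_nonneg.2 hc.le), Real.dist_eq, Real.dist_eq, inv_mul_eq_div,
    le_div_iff₀ hc]
  linarith

/-- The relation `r' = 1/g` behind the cancellation in the energy identity. -/
theorem hasDerivAt_radius (hU : IsAngularVelocity r₁ r₂ U) {y : ℝ}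
    (hy : y ∈ Ioo (leftEnd r₁ r₂ U) (rightEnd r₁ r₂ U)) :
    HasDerivAt (radius r₁ r₂ U) (gCoeff r₁ r₂ U y)⁻¹ y := by
  obtain ⟨K, hK⟩ := hU.lipschitzOnWith_radius
  have hy' := Ioo_subset_Icc_self hy
  have hmem := hU.radius_mem hy'
  have heq := hU.apply_radius hy'
  have hnhds := Icc_mem_nhds hy.1 hy.2
  -- `U` sends `r₁` and `r₂` to the ends of its range, which an interior `y` avoids; hence `U` has a
  -- two-sided derivative at the preimage.
  have hne : radius r₁ r₂ U y ≠ r₁ ∧ radius r₁ r₂ U y ≠ r₂ := by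
    constructor <;> intro h <;> rw [h] at heq <;>
      rcases le_total (U r₁) (U r₂) with hle | hle <;>
      simp only [leftEnd, rightEnd, min_eq_left hle, min_eq_right hle, max_eq_left hle,
        max_eq_right hle, mem_Ioo] at hy <;> linarith [hy.1, hy.2]
  refine HasDerivAt.of_local_left_inverse (hK.continuousOn.continuousAt hnhds)
    (hU.hasDerivAt ⟨lt_of_le_of_ne hmem.1 hne.1.symm, lt_of_le_of_ne hmem.2 hne.2⟩)
    (hU.deriv_ne_zero _ hmem) ?_
  filter_upwards [hnhds] with z hz using hU.apply_radius hz

theorem lipschitzOnWith_gCoeff (hU : IsAngularVelocity r₁ r₂ U) :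
    ∃ K : ℝ≥0, LipschitzOnWith K (gCoeff r₁ r₂ U) (Icc (leftEnd r₁ r₂ U) (rightEnd r₁ r₂ U)) := by
  obtain ⟨K₁, h₁⟩ := hU.lipschitzOnWith_radius
  obtain ⟨K₂, h₂⟩ := hU.lipschitz_deriv
  exact ⟨K₂ * K₁, h₂.comp h₁ fun y hy => hU.radius_mem hy⟩

end IsAngularVelocity

/-- Serves to make `r/g` an admissible multiplier for the test function. -/
theorem lipschitzOnWith_div {f g : ℝ → ℝ} {s : Set ℝ} {K₁ K₂ : ℝ≥0} {F G c : ℝ} (hc : 0 < c)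
    (hf : LipschitzOnWith K₁ f s) (hg : LipschitzOnWith K₂ g s) (hfF : ∀ x ∈ s, |f x| ≤ F)
    (hgG : ∀ x ∈ s, |g x| ≤ G) (hgc : ∀ x ∈ s, c ≤ |g x|) :
    ∃ K : ℝ≥0, LipschitzOnWith K (fun x => f x / g x) s := by
  refine ⟨((K₁ * G + F * K₂) / c ^ 2).toNNReal, LipschitzOnWith.of_dist_le_mul fun x hx y hy => ?_⟩
  have h0 : 0 ≤ G := (abs_nonneg _).trans (hgG x hx)
  have h1 : 0 ≤ F := (abs_nonneg _).trans (hfF x hx)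
  have hgx : 0 < |g x| := hc.trans_le (hgc x hx)
  have hgy : 0 < |g y| := hc.trans_le (hgc y hy)
  have d1 := hf.dist_le_mul x hx y hy
  have d2 := hg.dist_le_mul x hx y hy
  rw [Real.dist_eq] at d1 d2 ⊢
  rw [Real.coe_toNNReal _ (by positivity), div_sub_div _ _ (abs_pos.1 hgx) (abs_pos.1 hgy), abs_div,
    abs_mul, div_le_iff₀ (by positivity)]
  have e : f x * g y - g x * f y = (f x - f y) * g y + f y * (g y - g x) := by ring
  have hnum : |f x * g y - g x * f y| ≤ (K₁ * G + F * K₂) * dist x y := by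
    rw [e]
    refine (abs_add_le _ _).trans ?_
    rw [abs_mul, abs_mul, abs_sub_comm (g y)]
    calc _ ≤ (K₁ * dist x y) * G + F * (K₂ * dist x y) := by
          gcongr
          · exact hgG y hy
          · exact hfF y hy
      _ = _ := by ring
  have hden : c ^ 2 ≤ |g x| * |g y| := by
    rw [sq]
    exact mul_le_mul (hgc x hx) (hgc y hy) hc.le hgx.le
  calc _ ≤ (K₁ * G + F * K₂) * dist x y := hnum
    _ = (K₁ * G + F * K₂) / c ^ 2 * dist x y * c ^ 2 := by field_simp
    _ ≤ _ := by gcongr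

theorem lipschitzOnWith_ofReal {f : ℝ → ℝ} {s : Set ℝ} {K : ℝ≥0} (hf : LipschitzOnWith K f s) :
    LipschitzOnWith K (fun x => (f x : ℂ)) s := by
  have h := Complex.isometry_ofReal.lipschitz.comp_lipschitzOnWith hf
  rwa [one_mul] at h

theorem IsWaveNumber.one_le_abs {k : ℝ} (hk : IsWaveNumber k) : 1 ≤ |k| := by
  obtain ⟨m, hm, rfl⟩ := hk
  have h1 : (1 : ℝ) ≤ |(m : ℝ)| := by exact_mod_cast Int.one_le_abs hm
  rw [abs_mul, abs_of_pos Real.two_pi_pos]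
  nlinarith [Real.pi_gt_three]

/-- Existence of an elliptic constant that is uniform in the wave number. -/
theorem IsAngularVelocity.exists_isEllipticConstant (hU : IsAngularVelocity r₁ r₂ U) :
    ∃ K : ℝ, 0 < K ∧ ∀ k : ℝ, IsWaveNumber k →
      IsEllipticConstant (leftEnd r₁ r₂ U) (rightEnd r₁ r₂ U) (gCoeff r₁ r₂ U) (radius r₁ r₂ U)
        k K := by
  set a := leftEnd r₁ r₂ U
  set b := rightEnd r₁ r₂ U
  set g := gCoeff r₁ r₂ U with hg
  set r := radius r₁ r₂ U with hr
  have hab : a < b := hU.leftEnd_lt_rightEnd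
  have hr1 := hU.pos
  have hr2 : 0 < r₂ := hr1.trans hU.lt
  obtain ⟨ε, c, M, hε, hc, hM, hb⟩ := hU.exists_bounds
  obtain ⟨K₁, hK₁⟩ := hU.lipschitzOnWith_radius
  obtain ⟨K₂, hK₂⟩ := hU.lipschitzOnWith_gCoeff
  have hrm : ∀ y ∈ Icc a b, r y ∈ Icc r₁ r₂ := fun y hy => hU.radius_mem hy
  have hgb : ∀ y ∈ Icc a b, c ≤ ε * g y ∧ ε * g y ≤ M := fun y hy => hb _ (hrm y hy)
  have hgabs : ∀ y ∈ Icc a b, |g y| = ε * g y := fun y hy => by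
    rw [← abs_of_pos (hc.trans_le (hgb y hy).1), abs_mul, hε, one_mul]
  have hε2 : ε * ε = 1 := by rw [← abs_mul_abs_self, hε, one_mul]
  obtain ⟨K₃, hK₃⟩ := lipschitzOnWith_div hc hK₁ hK₂ (F := r₂) (G := M)
    (fun y hy => by
      rw [abs_of_nonneg (hr1.le.trans (hrm y hy).1)]
      exact (hrm y hy).2)
    (fun y hy => (hgabs y hy).trans_le (hgb y hy).2)
    (fun y hy => (hgb y hy).1.trans_eq (hgabs y hy).symm)
  have hrH := isH1_of_lipschitzOnWith hab.le (lipschitzOnWith_ofReal hK₁)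
  have hρL := lipschitzOnWith_ofReal hK₃
  have hρH := isH1_of_lipschitzOnWith hab.le hρL
  -- The coercivity constant: `r₁ c` bounds `r |g|` from below and `(r₂ M)⁻¹` bounds its inverse. In
  -- the quotient below, `r₂ / c` bounds `r/|g|` and `K₃` bounds the derivative of `r/g`.
  have hc₀ : 0 < min (r₁ * c) (r₂ * M)⁻¹ := lt_min (by positivity) (by positivity)
  refine ⟨(r₂ / c + K₃) / min (r₁ * c) (r₂ * M)⁻¹, by positivity, fun k hk t w Φ hΦ => ?_⟩
  have hIcc : ∀ᵐ y ∂(intervalMeasure a b), y ∈ Icc a b :=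
    (ae_mem_Ioo a b).mono fun y hy => Ioo_subset_Icc_self hy
  refine hΦ.hTildeNorm_le hab hk.one_le_abs (Lp.memLp w) hrH hρH ?_ hε hc₀ ?_ ?_ (by positivity)
    K₃.2 ?_ (ae_norm_deriv_le_of_lipschitzOnWith hρL)
  · filter_upwards [ae_mem_Ioo a b] with y hy
    exact (hU.hasDerivAt_radius hy).ofReal_comp.deriv
  · filter_upwards [hIcc] with y hy
    refine (min_le_left _ _).trans ?_
    calc r₁ * c ≤ r y * (ε * g y) :=
          mul_le_mul (hrm y hy).1 (hgb y hy).1 hc.le (hr1.le.trans (hrm y hy).1)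
      _ = _ := by ring
  · filter_upwards [hIcc] with y hy
    refine (min_le_right _ _).trans ?_
    have hry : 0 < r y := hr1.trans_le (hrm y hy).1
    have hgy := hc.trans_le (hgb y hy).1
    have e : ε * (r y * g y)⁻¹ = (r y * (ε * g y))⁻¹ := by
      have hε0 : ε⁻¹ = ε := inv_eq_of_mul_eq_one_right hε2
      rw [mul_left_comm, mul_inv ε, hε0]
    rw [e]
    refine inv_anti₀ (by positivity) ?_
    exact mul_le_mul (hrm y hy).2 (hgb y hy).2 hgy.le hr2.le
  · filter_upwards [hIcc] with y hy
    rw [Complex.norm_real, Real.norm_eq_abs, abs_div, hgabs y hy,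
      abs_of_nonneg (hr1.le.trans (hrm y hy).1)]
    exact div_le_div₀ hr2.le (hrm y hy).2 hc (hgb y hy).1

end AngularVelocity

/-! ### Evolution of the weighted energy -/

section Evolution

variable {a b : ℝ}

theorem ae_norm_le_supNorm {f : ℝ → ℂ} (hf : MemLp f ∞ (intervalMeasure a b)) :
    ∀ᵐ y ∂(intervalMeasure a b), ‖f y‖ ≤ supNorm a b f := by
  filter_upwards [ae_le_eLpNormEssSup (f := f) (μ := intervalMeasure a b)] with y hy
  rw [← eLpNorm_exponent_top] at hy
  rw [← toReal_enorm]
  exact ENNReal.toReal_mono hf.2.ne hy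

/-- Polarization for a symmetric operator. The difference `u - v` stands alone, so only continuity
of `s ↦ A(s) W(s)` is needed to differentiate the energy. -/
theorem weightForm_sub_weightForm (hab : a < b) (k s : ℝ) (u v : L2 a b) :
    weightForm a b k s u - weightForm a b k s v =
      (inner ℂ (u - v) (weightOp a b k s u + weightOp a b k s v) : ℂ).re := by
  have h : (inner ℂ u (weightOp a b k s v) : ℂ).re = (inner ℂ v (weightOp a b k s u) : ℂ).re := by
    rw [← inner_weightOp_left hab, ← inner_conj_symm, Complex.conj_re]
  simp only [weightForm, inner_sub_left, inner_add_right, Complex.sub_re, Complex.add_re, h]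
  ring

/-- Combines the uniform operator bound with Lipschitz dependence on time. -/
theorem tendsto_weightOp (hab : a < b) (k : ℝ) {t : ℝ} {l : Filter ℝ} (hl : l ≤ nhds t)
    {W : ℝ → L2 a b} (hW : Filter.Tendsto W l (nhds (W t))) :
    Filter.Tendsto (fun s => weightOp a b k s (W s)) l (nhds (weightOp a b k t (W t))) := by
  rw [tendsto_iff_norm_sub_tendsto_zero] at hW ⊢
  have h1 : Filter.Tendsto (fun s => |s - t|) l (nhds 0) := by
    have : Filter.Tendsto (fun s : ℝ => |s - t|) (nhds t) (nhds |t - t|) :=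
      (by fun_prop : Continuous fun s : ℝ => |s - t|).tendsto t
    rw [sub_self, abs_zero] at this
    exact this.mono_left hl
  have h2 := (hW.const_mul (Real.exp (Real.pi / 2))).add
    ((h1.const_mul (Real.exp (Real.pi / 2))).mul_const ‖W t‖)
  refine squeeze_zero (fun _ => norm_nonneg _) (fun s => ?_)
    (by simpa using h2)
  calc _ = ‖weightOp a b k s (W s - W t) +
        (weightOp a b k s (W t) - weightOp a b k t (W t))‖ := by
        rw [weightOp_sub hab, sub_add_sub_cancel]
    _ ≤ _ := (norm_add_le _ _).trans
        (add_le_add (norm_weightOp_le hab k s _) (norm_weightOp_sub_le hab k s t _))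

/-- The product rule for the weighted energy along a differentiable curve. -/
theorem hasDerivWithinAt_weightForm (hab : a < b) (k : ℝ) {t : ℝ} {J : Set ℝ} {W : ℝ → L2 a b}
    {V : L2 a b} (hW : HasDerivWithinAt W V J t) :
    HasDerivWithinAt (fun s => weightForm a b k s (W s))
      (deriv (fun s => weightForm a b k s (W t)) t +
        2 * (inner ℂ V (weightOp a b k t (W t)) : ℂ).re) J t := by
  have h1 : HasDerivWithinAt (fun s => weightForm a b k s (W t))
      (deriv (fun s => weightForm a b k s (W t)) t) J t :=
    (hasDerivAt_weightForm hab k t (W t)).differentiableAt.hasDerivAt.hasDerivWithinAt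
  -- `h1` moves the weight with `W t` frozen; here `W` moves under the weight at time `s`. By
  -- polarization the slope is the real part of the slope of `W` paired with `A(s) (W s + W t)`.
  have h2 : HasDerivWithinAt
      (fun s => weightForm a b k s (W s) - weightForm a b k s (W t))
      (2 * (inner ℂ V (weightOp a b k t (W t)) : ℂ).re) J t := by
    rw [hasDerivWithinAt_iff_tendsto_slope] at hW ⊢
    have hl : nhdsWithin t (J \ {t}) ≤ nhds t := nhdsWithin_le_nhds
    have hWc : Filter.Tendsto W (nhdsWithin t (J \ {t})) (nhds (W t)) :=
      ((hasDerivWithinAt_iff_tendsto_slope.2 hW).continuousWithinAt.mono sdiff_subset).tendsto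
    have hz := (tendsto_weightOp hab k hl hWc).add
      (tendsto_weightOp (W := fun _ => W t) hab k hl tendsto_const_nhds)
    have hin := (Complex.continuous_re.tendsto _).comp (hW.inner (𝕜 := ℂ) hz)
    have e : (inner ℂ V (weightOp a b k t (W t) + weightOp a b k t (W t)) : ℂ).re =
        2 * (inner ℂ V (weightOp a b k t (W t)) : ℂ).re := by
      rw [inner_add_right, Complex.add_re]
      ring
    rw [e] at hin
    refine hin.congr fun s => ?_
    simp only [Function.comp_apply, slope, vsub_eq_sub, sub_self, sub_zero]
    rw [inner_smul_left_eq_smul, weightForm_sub_weightForm hab, Complex.real_smul,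
      Complex.re_ofReal_mul, smul_eq_mul]
  refine (h1.add h2).congr_of_eventuallyEq (Filter.Eventually.of_forall fun s => ?_) ?_ <;>
    simp

/-- The forcing term is controlled by the energy norms. -/
theorem norm_inner_forcing_le (hab : a < b) {k t : ℝ} (hk : k ≠ 0) {h Φ : ℝ → ℂ} {K : ℝ≥0}
    (hh : LipschitzOnWith K h (Icc a b)) (hΦ : IsH10 a b Φ) {V : L2 a b}
    (hV : ∀ᵐ y ∂(intervalMeasure a b), V y = Complex.I * h y / (k : ℂ) * Φ y) (u : L2 a b) :
    ‖(inner ℂ V u : ℂ)‖ ≤ |k|⁻¹ * (supNorm a b h + |k|⁻¹ * supNorm a b (deriv h)) *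
      hTildeNorm a b k t Φ * hTildeNegNorm a b k t u := by
  have hH := isH1_of_lipschitzOnWith hab.le hh
  have hsup := ae_norm_le_supNorm
    (memLp_top_of_absolutelyContinuous hab.le (hH.absolutelyContinuous hab.le))
  have hsup' := ae_norm_le_supNorm (memLp_top_of_bound hH.1.aestronglyMeasurable K
    (ae_norm_deriv_le_of_lipschitzOnWith hh))
  have hmul := hTildeNorm_mul_le (k := k) hab.le hH hΦ.1 t ENNReal.toReal_nonneg
    ENNReal.toReal_nonneg hsup hsup'
  have hdual := norm_integral_conj_mul_le hab hk t (Lp.memLp u) (hΦ.mul_left hab.le hH)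
  have e : (inner ℂ V u : ℂ) = star (Complex.I / (k : ℂ)) *
      ∫ y, star (h y * Φ y) * u y ∂(intervalMeasure a b) := by
    rw [inner_eq_integral, ← integral_const_mul]
    refine integral_congr_ae ?_
    filter_upwards [hV] with y hy
    rw [hy]
    simp only [star_mul', star_div₀]
    ring
  rw [e, norm_mul, norm_star, norm_div, Complex.norm_I, Complex.norm_real, Real.norm_eq_abs,
    one_div, mul_assoc, mul_assoc]
  refine mul_le_mul_of_nonneg_left (hdual.trans ?_) (by positivity)
  rw [← mul_assoc]
  exact mul_le_mul_of_nonneg_right hmul (hTildeNegNorm_nonneg _ _ _ _ _)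

/-- Dissipation of the weighted energy along a solution of the scattering equation. -/
theorem IsScatteringSolution.exists_hasDerivWithinAt {g r : ℝ → ℝ} {k C₂ C δ : ℝ} (hab : a < b)
    (hk : k ≠ 0) (hC₂ : 0 < C₂) (hwc : IsWeightConstant a b k C₂) (hC : 0 < C)
    (hec : IsEllipticConstant a b g r k (C / 2)) {h : ℝ → ℂ} {K : ℝ≥0}
    (hh : LipschitzOnWith K h (Icc a b))
    (hsmall : |k|⁻¹ * (supNorm a b h + |k|⁻¹ * supNorm a b (deriv h)) ≤ 1 / C * (1 / C₂ - δ))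
    {J : Set ℝ} {W : ℝ → L2 a b} (hW : IsScatteringSolution a b g r h k J W) {t : ℝ}
    (ht : t ∈ J) :
    ∃ I' : ℝ, HasDerivWithinAt (fun s => weightForm a b k s (W s)) I' J t ∧
      I' ≤ -δ * hTildeNegNorm a b k t (W t) *
        hTildeNegNorm a b k t (weightOp a b k t (W t)) := by
  obtain ⟨Φ, V, hΦ, hV, hd⟩ := hW t ht
  refine ⟨_, hasDerivWithinAt_weightForm hab k hd, ?_⟩
  have hforce := norm_inner_forcing_le (t := t) hab hk hh hΦ.1 hV (weightOp a b k t (W t))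
  have hell := hec t (W t) Φ hΦ
  have hweight := hwc t (W t)
  set D := deriv (fun s => weightForm a b k s (W t)) t
  set n := hTildeNegNorm a b k t (W t)
  set n' := hTildeNegNorm a b k t (weightOp a b k t (W t))
  set S := |k|⁻¹ * (supNorm a b h + |k|⁻¹ * supNorm a b (deriv h))
  have hn : 0 ≤ n := hTildeNegNorm_nonneg _ _ _ _ _
  have hn' : 0 ≤ n' := hTildeNegNorm_nonneg _ _ _ _ _
  have hS : 0 ≤ S := by
    have h1 : 0 ≤ supNorm a b h := ENNReal.toReal_nonneg
    have h2 : 0 ≤ supNorm a b (deriv h) := ENNReal.toReal_nonneg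
    positivity
  have hre := (Complex.re_le_norm (inner ℂ V (weightOp a b k t (W t)))).trans hforce
  have h1 : S * hTildeNorm a b k t Φ * n' ≤ S * (C / 2 * n) * n' := by gcongr
  have h2 : S * (C / 2 * n) * n' ≤ 1 / C * (1 / C₂ - δ) * (C / 2 * n) * n' := by gcongr
  -- The `1/2` in the elliptic constant offsets the factor `2` in the derivative of the quadratic
  -- form; the `1 / C₂` part then cancels against the dissipation and leaves `-δ`.
  have h3 : 1 / C * (1 / C₂ - δ) * (C / 2 * n) * n' = (1 / C₂ - δ) * (n * n') / 2 := by
    field_simp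
  have h4 : D ≤ -(1 / C₂ * (n * n')) := by
    rw [one_div, inv_mul_eq_div, le_neg, div_le_iff₀ hC₂]
    linarith
  linarith

end Evolution

end EulerScattering

/-! ### The stability theorem -/

theorem theorem3p6 :
    -- existence of the absolute constant `C₂`
    (∃ C₂ : ℝ, Real.exp (-Real.pi) ≤ C₂ ∧ C₂ ≤ Real.exp Real.pi ∧
      ∀ a b : ℝ, a < b → ∀ k : ℝ, IsWaveNumber k → IsWeightConstant a b k C₂) ∧
    ∀ (r₁ r₂ : ℝ) (U : ℝ → ℝ), IsAngularVelocity r₁ r₂ U →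
      ∀ (a b : ℝ) (g r : ℝ → ℝ), a = leftEnd r₁ r₂ U → b = rightEnd r₁ r₂ U →
        g = gCoeff r₁ r₂ U → r = radius r₁ r₂ U →
      -- existence of the constant `C`, uniform in `k` and `t`
      (∃ C : ℝ, 0 < C ∧ ∀ k : ℝ, IsWaveNumber k → IsEllipticConstant a b g r k (C / 2)) ∧
      -- stability, for all admissible constants
      ∀ k : ℝ, IsWaveNumber k →
      ∀ C₂ : ℝ, 0 < C₂ → IsWeightConstant a b k C₂ →
      ∀ C : ℝ, 0 < C → IsEllipticConstant a b g r k (C / 2) →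
      ∀ h : ℝ → ℂ, (∃ K : ℝ≥0, LipschitzOnWith K h (Icc a b)) →
      ∀ δ : ℝ, 0 < δ →
      |k|⁻¹ * (supNorm a b h + |k|⁻¹ * supNorm a b (deriv h)) ≤ 1 / C * (1 / C₂ - δ) →
      ∀ J : Set ℝ, J.OrdConnected → J.Nontrivial →
      ∀ W : ℝ → L2 a b, IsScatteringSolution a b g r h k J W →
        AntitoneOn (fun t => weightForm a b k t (W t)) J ∧
        (∀ t ∈ J, ∃ I' : ℝ,
          HasDerivWithinAt (fun s => weightForm a b k s (W s)) I' J t ∧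
          I' ≤ -δ * hTildeNegNorm a b k t (W t) *
            hTildeNegNorm a b k t (weightOp a b k t (W t)) ∧
          -δ * hTildeNegNorm a b k t (W t) *
            hTildeNegNorm a b k t (weightOp a b k t (W t)) ≤ 0) ∧
        (0 ∈ J → ∀ t ∈ J, 0 ≤ t →
          Real.exp (-Real.pi) * ‖W t‖ ^ 2 ≤ weightForm a b k t (W t) ∧
          weightForm a b k t (W t) ≤ weightForm a b k 0 (W 0) ∧
          weightForm a b k 0 (W 0) ≤ Real.exp Real.pi * ‖W 0‖ ^ 2 ∧
          ‖W t‖ ≤ Real.exp Real.pi * ‖W 0‖) := by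
  refine ⟨⟨Real.exp (Real.pi / 2), ?_, ?_, fun a b hab k hk =>
    isWeightConstant_exp_pi_div_two hab hk.ne_zero⟩, ?_⟩
  · exact Real.exp_le_exp.2 (by linarith [Real.pi_pos])
  · exact Real.exp_le_exp.2 (by linarith [Real.pi_pos])
  intro r₁ r₂ U hU a b g r ha hb hg hr
  have hab : a < b := by
    rw [ha, hb]
    exact hU.leftEnd_lt_rightEnd
  refine ⟨?_, ?_⟩
  · obtain ⟨K, hK, H⟩ := hU.exists_isEllipticConstant
    -- The elliptic bound is stated with `C / 2`, hence the doubling.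
    refine ⟨2 * K, by positivity, fun k hk => ?_⟩
    rw [ha, hb, hg, hr, mul_div_cancel_left₀ K two_ne_zero]
    exact H k hk
  intro k hk C₂ hC₂ hwc C hC hec h ⟨K, hh⟩ δ hδ hsmall J hJ _ W hW
  choose! I' hI' hle using fun t (ht : t ∈ J) =>
    hW.exists_hasDerivWithinAt hab hk.ne_zero hC₂ hwc hC hec hh hsmall ht
  have hdiss : ∀ t, -δ * hTildeNegNorm a b k t (W t) *
      hTildeNegNorm a b k t (weightOp a b k t (W t)) ≤ 0 := fun t => by
    have := mul_nonneg (mul_nonneg hδ.le (hTildeNegNorm_nonneg a b k t (W t)))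
      (hTildeNegNorm_nonneg a b k t (weightOp a b k t (W t)))
    linarith
  have hanti : AntitoneOn (fun t => weightForm a b k t (W t)) J :=
    antitoneOn_of_hasDerivWithinAt_nonpos hJ.convex (fun t ht => (hI' t ht).continuousWithinAt)
      (fun t ht => (hI' t (interior_subset ht)).mono interior_subset)
      (fun t ht => (hle t (interior_subset ht)).trans (hdiss t))
  refine ⟨hanti, fun t ht => ⟨I' t, hI' t ht, hle t ht, hdiss t⟩, fun h0 t ht ht0 => ?_⟩
  have h1 : Real.exp (-Real.pi) * ‖W t‖ ^ 2 ≤ weightForm a b k t (W t) := by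
    refine le_trans ?_ (le_weightForm hab k t (W t))
    gcongr
    linarith [Real.pi_pos]
  have h2 : weightForm a b k 0 (W 0) ≤ Real.exp Real.pi * ‖W 0‖ ^ 2 := by
    refine (weightForm_le hab k 0 (W 0)).trans ?_
    gcongr
    linarith [Real.pi_pos]
  have h3 := hanti h0 ht ht0
  refine ⟨h1, h3, h2, ?_⟩
  refine (pow_le_pow_iff_left₀ (norm_nonneg _) (by positivity) two_ne_zero).1 ?_
  -- Clearing `exp (-π)` on the left gives the squared bound with `exp (2π)`, whose root is `exp π`.
  have h4 := mul_le_mul_of_nonneg_left ((h1.trans h3).trans h2) (Real.exp_pos Real.pi).le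
  rw [← mul_assoc, ← Real.exp_add, add_neg_cancel, Real.exp_zero, one_mul] at h4
  linarith
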